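/- Let $G=(V,E)$ be a finite acyclic directed multigraph with unit-capacity channels, one source node $s$ without incoming channels, a set $T\subseteq V\setminus\{s\}$ of sink nodes without outgoing channels, and $J=V\setminus(\{s\}\cup T)$ the set of internal nodes. Let $C_t$ be the minimum cut capacity between $s$ and $t$, let $2\le\omega\le\min_{t\in T}C_t$, and put $\delta_t=C_t-\omega$. Let $\mathbb F$ be a finite field. **Codes.** An $\omega$-dimensional $\mathbb F$-valued linear network error correction code is given by coefficients $k_{d,e}\in\mathbb F$ for all adjacent pairs of channels $(d,e)$; here $In(s)=\{d'_1,\dots,d'_\omega\}$ consists of $\omega$ imaginary message channels. Its extended global encoding kernels $\tilde f_e\in\mathbb F^{In(s)\cup E}$ are determined by $\tilde f_{d'_i}=1_{d'_i}$ and $\tilde f_e=\sum_{d\in In(tail(e))}k_{d,e}\tilde f_d+1_e$ for $e\in E$. For $t\in T$ let $\begin{bmatrix}F_t\\G_t\end{bmatrix}=[\tilde f_e:e\in In(t)]$ with $F_t$ of size $\omega\times|In(t)|$ and $G_t$ of size $|E|\times|In(t)|$. Put $\Phi(t)=\{XF_t:X\in\mathbb F^\omega\}$ and, for an error pattern $\rho\subseteq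 E$, $\Delta(t,\rho)=\{ZG_t: Z\in\mathbb F^{E},\ Z_e=0\text{ for }e\notin\rho\}$. Let $rank_t(\rho)$ be the least $|\rho'|$ such that $\Delta(t,\rho)\subseteq\Delta(t,\rho')$ for every linear network code. The code is regular if $\dim\Phi(t)=\omega$ for all $t\in T$; then $d_{\min}^{(t)}=\min\{rank_t(\rho):\Delta(t,\rho)\cap\Phi(t)\ne\{0\}\}$, and a regular code is called network MDS if $d_{\min}^{(t)}=\delta_t+1$ for all $t\in T$. Let $R_t(\delta)=\{\rho:|\rho|=rank_t(\rho)=\delta\}$ and, for a network MDS code $c$, $Q_c(t)=\{\rho:\Delta(t,\rho)\cap\Phi(t)\neq\{0\},\ |\rho|=d_{\min}^{(t)}\}$. **Random construction.** Choose all local coding coefficients of an $\omega$-dimensional code $c$, and the entries of a vector $\vec k\in\mathbb F^{\omega-1}$, independently and uniformly at random from $\mathbb F$. Let $C_\omega$ be the event that $c$ is a network MDS code, and let $C_{\omega-1}$ be the event that the vectors $$\tilde f_e^{(\omega-1)}(\vec k)=\begin{bmatrix} I_{\omega-1}&\vec k&0\\0&0&I_{|E|}\end{bmatrix}\tilde f_e\qquad(e\in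 E)$$ are the extended global encoding kernels of an $(\omega-1)$-dimensional network MDS code with the same local encoding kernels at all internal nodes as $c$. **Theorem.** 1. For every $\omega$-dimensional network MDS code $c$, a uniformly random $\vec k\in\mathbb F^{\omega-1}$ satisfies $\Pr(C_{\omega-1}\mid c)\ge 1-\frac{\sum_{t\in T}|Q_c(t)|}{|\mathbb F|}$. 2. If $\sum_{t\in T}|R_t(\delta_t)|\le|\mathbb F|-1$, then $$\Pr(C_\omega\cap C_{\omega-1})\ \ge\ \left[1-\frac{\bar Q}{|\mathbb F|}\right]\cdot\left[1-\frac{\sum_{t\in T}|R_t(\delta_t)|}{|\mathbb F|-1}\right]^{|J|+1},$$ where $\bar Q=\mathbb E\big[\sum_{t\in T}|Q_c(t)|\,\big|\,C_\omega\big]$ is the average of $\sum_{t\in T}|Q_c(t)|$ over all $\omega$-dimensional $\mathbb F$-valued network MDS codes $c$ on $G$ (with $\bar Q=0$ if there are none). 3. For fixed $G$ and $\omega$, both this lower bound and $\Pr(C_\omega\cap C_{\omega-1})$ tend to $1$ as $|\mathbb F|\to\infty$. -/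

import Mathlib

universe u v w

/-- A single source multicast network: a finite acyclic directed multigraph with node type `V` and
channel type `E` (parallel channels allowed, every channel has unit capacity), a source node without
incoming channels and a set of sink nodes without outgoing channels. -/
structure Network (V : Type u) (E : Type v) where
  tail : E → V
  head : E → V
  source : V
  sinks : Finset V
  source_notMem_sinks : source ∉ sinks
  head_ne_source : ∀ e, head e ≠ source
  tail_notMem_sinks : ∀ e, tail e ∉ sinks
  acyclic : ∀ i, ¬ Relation.TransGen (fun a b => ∃ e, tail e = a ∧ head e = b) i i

namespace Network

variable {V : Type u} {E : Type v}

/-- The set `J` of internal nodes. -/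
def internalNodes [Fintype V] [DecidableEq V] (N : Network V E) : Finset V :=
  Finset.univ \ insert N.source N.sinks

/-- `B` is a cut between the source and `t`: removing the channels of `B` disconnects the source
from `t`. -/
def IsCut (N : Network V E) (t : V) (B : Finset E) : Prop :=
  ¬ Relation.ReflTransGen (fun a b => ∃ e, e ∉ B ∧ N.tail e = a ∧ N.head e = b) N.source t

/-- The minimum cut capacity `C_t` between the source and `t`. -/
noncomputable def minCut (N : Network V E) (t : V) : ℕ :=
  sInf {n | ∃ B : Finset E, N.IsCut t B ∧ B.card = n}

/-- The redundancy `δ_t = C_t - ω`; it is used only when `ω ≤ C_t`. -/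
noncomputable def redundancy (N : Network V E) (ω : ℕ) (t : V) : ℕ :=
  N.minCut t - ω

/-- The channel `d` enters the node that the channel `e` leaves. -/
def Adj (N : Network V E) (d e : E) : Prop := N.head d = N.tail e

theorem adj_wellFounded [Finite E] (N : Network V E) : WellFounded N.Adj := by
  have key : ∀ d e, Relation.TransGen N.Adj d e →
      Relation.TransGen (fun a b => ∃ x, N.tail x = a ∧ N.head x = b) (N.tail d) (N.tail e) := by
    intro d e h
    induction h with
    | single hab => exact Relation.TransGen.single ⟨d, rfl, hab⟩
    | @tail b c' _ hbc ih => exact Relation.TransGen.tail ih ⟨b, rfl, hbc⟩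
  have : Std.Irrefl (Relation.TransGen N.Adj) := ⟨fun d h => N.acyclic _ (key d d h)⟩
  have hwf : WellFounded (Relation.TransGen N.Adj) := Finite.wellFounded_of_trans_of_irrefl _
  exact Subrelation.wf (fun h => Relation.TransGen.single h) hwf

/-- An `ω`-dimensional `F`-valued linear network error correction code in its local description.
The first component holds the coefficients `k_{d'_i,e}` for the imaginary message channels `d'_i`
(`i : Fin ω`) and the channels `e` leaving the source (the local encoding kernel at the source);
the second one holds the coefficients `k_{d,e}` for adjacent pairs of real channels (the local
encoding kernels at the internal nodes). -/
abbrev Code (N : Network V E) (F : Type w) (ω : ℕ) : Type (max v w) :=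
  ({p : Fin ω × E // N.tail p.2 = N.source} → F) ×
    ({p : E × E // N.head p.1 = N.tail p.2} → F)

namespace Code

variable [Fintype E] [DecidableEq E] [DecidableEq V] {N : Network V E}
variable {F : Type w} [Field F] {ω : ℕ}

/-- The extended global encoding kernel of a channel `e`, with entries indexed by the imaginary
message channels `d'_i` and the channels: `f̃_e = ∑_{d ∈ In(tail e)} k_{d,e} f̃_d + 1_e`, where
`f̃_{d'_i} = 1_{d'_i}` and `In(source)` consists of the imaginary message channels. -/
noncomputable def extKernel (c : N.Code F ω) : E → (Fin ω ⊕ E → F) :=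
  N.adj_wellFounded.fix fun e f =>
    (if h : N.tail e = N.source then
        ∑ i : Fin ω, c.1 ⟨(i, e), h⟩ • Pi.single (Sum.inl i) (1 : F)
      else 0)
    + (∑ d : {d : E // N.head d = N.tail e}, c.2 ⟨(d.1, e), d.2⟩ • f d.1 d.2)
    + Pi.single (Sum.inr e) (1 : F)

theorem extKernel_eq (c : N.Code F ω) (e : E) :
    c.extKernel e =
      (if h : N.tail e = N.source then
          ∑ i : Fin ω, c.1 ⟨(i, e), h⟩ • Pi.single (Sum.inl i) (1 : F)
        else 0)
      + (∑ d : {d : E // N.head d = N.tail e}, c.2 ⟨(d.1, e), d.2⟩ • c.extKernel d.1)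
      + Pi.single (Sum.inr e) (1 : F) := by
  unfold extKernel
  rw [WellFounded.fix_eq]

/-- The upper block `F_t` of the decoding matrix at `t`; its columns are indexed by `In(t)`. -/
noncomputable def messageMatrix (c : N.Code F ω) (t : V) :
    Matrix (Fin ω) {e : E // N.head e = t} F :=
  Matrix.of fun i e => c.extKernel e.1 (Sum.inl i)

/-- The lower block `G_t` of the decoding matrix at `t`. -/
noncomputable def errorMatrix (c : N.Code F ω) (t : V) :
    Matrix E {e : E // N.head e = t} F :=
  Matrix.of fun d e => c.extKernel e.1 (Sum.inr d)

/-- The message space `Φ(t) = {X F_t : X ∈ F^ω}`. -/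
noncomputable def messageSpace (c : N.Code F ω) (t : V) :
    Submodule F ({e : E // N.head e = t} → F) :=
  LinearMap.range (c.messageMatrix t).vecMulLinear

/-- The error vectors that match the error pattern `ρ`. -/
def matching (F : Type w) [Field F] (ρ : Finset E) : Submodule F (E → F) where
  carrier := {Z | ∀ e, e ∉ ρ → Z e = 0}
  zero_mem' := fun _ _ => rfl
  add_mem' := fun {a b} ha hb e he => by
    rw [Pi.add_apply, ha e he, hb e he, add_zero]
  smul_mem' := fun r a ha e he => by
    rw [Pi.smul_apply, ha e he, smul_zero]

/-- The error space `Δ(t,ρ) = {Z G_t : Z ∈ F^E matching ρ}`. -/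
noncomputable def errorSpace (c : N.Code F ω) (t : V) (ρ : Finset E) :
    Submodule F ({e : E // N.head e = t} → F) :=
  (matching F ρ).map (c.errorMatrix t).vecMulLinear

end Code

section Parameters

variable [Fintype E] [DecidableEq E] [DecidableEq V]

/-- `ρ₁` is dominated by `ρ₂` with respect to `t`: `Δ(t,ρ₁) ⊆ Δ(t,ρ₂)` for every (`F`-valued)
linear network code. -/
def Dominated (N : Network V E) (F : Type w) [Field F] (t : V) (ρ₁ ρ₂ : Finset E) : Prop :=
  ∀ (m : ℕ) (c : N.Code F m), c.errorSpace t ρ₁ ≤ c.errorSpace t ρ₂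

/-- The rank of an error pattern with respect to `t`. -/
noncomputable def rank (N : Network V E) (F : Type w) [Field F] (t : V) (ρ : Finset E) : ℕ :=
  sInf {n | ∃ ρ' : Finset E, N.Dominated F t ρ ρ' ∧ ρ'.card = n}

open Classical in
/-- `R_t(δ)`: the error patterns `ρ` with `|ρ| = rank_t(ρ) = δ`. -/
noncomputable def R (N : Network V E) (F : Type w) [Field F] (t : V) (δ : ℕ) :
    Finset (Finset E) :=
  Finset.univ.filter fun ρ => ρ.card = δ ∧ N.rank F t ρ = δ

end Parameters

namespace Code

variable [Fintype E] [DecidableEq E] [DecidableEq V] {N : Network V E}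
variable {F : Type w} [Field F] {ω : ℕ}

/-- A code is regular if `dim Φ(t) = ω` for every sink `t`. -/
def IsRegular (c : N.Code F ω) : Prop :=
  ∀ t ∈ N.sinks, Module.finrank F (c.messageSpace t) = ω

/-- The minimum distance at `t`: the least rank of an error pattern whose error space meets the
message space nontrivially. -/
noncomputable def minDist (c : N.Code F ω) (t : V) : ℕ :=
  sInf {n | ∃ ρ : Finset E,
    0 < Module.finrank F ↥(c.errorSpace t ρ ⊓ c.messageSpace t) ∧ N.rank F t ρ = n}

/-- A network MDS code: a regular code with `d_min^(t) = C_t - ω + 1` at every sink `t`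
(written without subtraction). -/
def IsMDS (c : N.Code F ω) : Prop :=
  c.IsRegular ∧ ∀ t ∈ N.sinks, c.minDist t + ω = N.minCut t + 1

open Classical in
/-- `Q(t)`: the error patterns `ρ` with `Δ(t,ρ) ∩ Φ(t) ≠ {0}` and `|ρ| = d_min^(t)`. -/
noncomputable def Q (c : N.Code F ω) (t : V) : Finset (Finset E) :=
  Finset.univ.filter fun ρ =>
    c.errorSpace t ρ ⊓ c.messageSpace t ≠ ⊥ ∧ ρ.card = c.minDist t

/-- Multiplication of an extended global encoding kernel by the block matrix
`[I_{ω-1} k 0; 0 0 I]`. -/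
def reduce (k : Fin (ω - 1) → F) (f : Fin ω ⊕ E → F) : Fin (ω - 1) ⊕ E → F :=
  Sum.elim
    (fun i => f (Sum.inl ⟨i.1, by have := i.2; omega⟩) +
      k i * f (Sum.inl ⟨ω - 1, by have := i.2; omega⟩))
    (fun e => f (Sum.inr e))

/-- The vectors `f̃_e^{(ω-1)}(k)` form the global description of an `(ω-1)`-dimensional network MDS
code that has the same local encoding kernel as `c` at every internal node. -/
def ReducesToMDS (c : N.Code F ω) (k : Fin (ω - 1) → F) : Prop :=
  ∃ c' : N.Code F (ω - 1),
    c'.2 = c.2 ∧ (∀ e, c'.extKernel e = reduce k (c.extKernel e)) ∧ c'.IsMDS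

end Code

/-- Probability of `A` under the uniform distribution on a finite type. -/
noncomputable def unifProb {α : Type*} [Fintype α] [Nonempty α] (A : Set α) : ℝ :=
  ((PMF.uniformOfFintype α).toOuterMeasure A).toReal

section Random

variable [Fintype E] [DecidableEq E] [DecidableEq V]

/-- `Pr(C_ω ∩ C_{ω-1})`: all local encoding coefficients of the `ω`-dimensional code and all entries
of `k` are chosen independently and uniformly from `F`. -/
noncomputable def successProb (N : Network V E) (F : Type w) [Field F] [Fintype F] (ω : ℕ) : ℝ :=
  unifProb {x : N.Code F ω × (Fin (ω - 1) → F) | x.1.IsMDS ∧ x.1.ReducesToMDS x.2}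

open Classical in
/-- The expectation of `∑_t |Q(t)|` for the random `ω`-dimensional code, conditioned on its being a
network MDS code, i.e. the average over all `ω`-dimensional network MDS codes. -/
noncomputable def meanQ (N : Network V E) (F : Type w) [Field F] [Fintype F] (ω : ℕ) : ℝ :=
  (∑ c : N.Code F ω with c.IsMDS, ∑ t ∈ N.sinks, ((c.Q t).card : ℝ)) /
    ((Finset.univ.filter fun c : N.Code F ω => c.IsMDS).card : ℝ)

/-- `∑_t |R_t(δ_t)|`. -/
noncomputable def sumR (N : Network V E) (F : Type w) [Field F] (ω : ℕ) : ℝ :=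
  ∑ t ∈ N.sinks, ((N.R F t (N.redundancy ω t)).card : ℝ)

/-- The lower bound `[1 - ∑_t|Q(t)|/|F|] [1 - ∑_t|R_t(δ_t)|/(|F|-1)]^{|J|+1}`, with the conditional
expectation of the random number `∑_t|Q(t)|`. -/
noncomputable def lowerBound [Fintype V] (N : Network V E) (F : Type w) [Field F] [Fintype F]
    (ω : ℕ) : ℝ :=
  (1 - N.meanQ F ω / (Fintype.card F : ℝ)) *
    (1 - N.sumR F ω / ((Fintype.card F : ℝ) - 1)) ^ (N.internalNodes.card + 1)

end Random

end Network

/-! ### Signals, error spaces and cuts -/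

namespace Network

open Matrix

variable {V : Type u} {E : Type v}

/-! Call a pair (t, ρ) decodable for a code if t can recover the message together with every error
vector supported on ρ. A code is MDS as soon as all pairs with t a sink and ρ in R_t(δ_t) are
decodable (`isMDS_of_decodable`): every pattern of rank at most δ_t is dominated by one in R_t(δ_t)
(`exists_dominated_mem_R`), so the minimum distance exceeds δ_t, and the Singleton bound
(`exists_singleton`) gives the reverse inequality. Each single pair is decodable for some code over
every field; this is a Menger-type statement, obtained from Hall's theorem (`exists_decodable`).

To treat all pairs at once, the coefficients are exposed node by node. With everything but one node
fixed, the word received from v = (X, Z) is a(v) + b(v)z, where z collects the coefficients.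
Acyclicity makes this affine in z, and b(v) is either zero or maps onto a space not depending on v.
A double count of kernel vectors shows that a fresh z destroys a decodable pair with probability at
most 1/(|F| - 1) (`Decodable.card_not_splice_le`). A partial assignment is kept as long as every
pair, separately, still has a decodable completion. A union bound over the pairs costs one factor
per node, and only the source and the |J| internal nodes have coefficients
(`card_forall_ge_of_blocks`, `card_isMDS_ge`).

For the reduction of dimension, the code given by k transmits exactly the messages of c in the
hyperplane whose last coordinate is ∑ X_i k_i. For ρ in Q_c(t) the error space meets the message
space in a line (`exists_forall_eq_smul`). That line lies in the hyperplane only if k solves one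
linear equation, which has at most a fraction 1/|F| of solutions (`card_mul_card_meets_le`). Summing
over all ρ gives the first claim, averaging over MDS codes the second. The third holds because |R_t|
and |Q_c(t)| are bounded by the number of subsets of E, whatever the field. -/

theorem transGen_tail_head (N : Network V E) {d e : E} (h : Relation.ReflTransGen N.Adj d e) :
    Relation.TransGen (fun a b => ∃ x, N.tail x = a ∧ N.head x = b) (N.tail d) (N.head e) := by
  induction h with
  | refl => exact .single ⟨d, rfl, rfl⟩
  | @tail b c _ hbc ih => exact ih.tail ⟨c, hbc.symm, rfl⟩

theorem head_ne_tail_of_reflTransGen (N : Network V E) {d e : E}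
    (h : Relation.ReflTransGen N.Adj d e) : N.head e ≠ N.tail d := fun he => by
  have := N.transGen_tail_head h
  rw [he] at this
  exact N.acyclic _ this

theorem not_adj_self (N : Network V E) (e : E) : ¬ N.Adj e e :=
  N.head_ne_tail_of_reflTransGen .refl

/-- Permits induction from downstream to upstream, opposite to the recursion that defines the
kernels. -/
theorem flip_adj_wellFounded [Finite E] (N : Network V E) :
    WellFounded (fun e d => N.Adj d e) := by
  have h1 := N.adj_wellFounded
  let r : E → E → Prop := fun e d => N.Adj d e
  have : Std.Irrefl (Relation.TransGen r) := ⟨fun d h =>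
    h1.transGen.irrefl.irrefl d (Relation.transGen_swap.1 h)⟩
  have hwf : WellFounded (Relation.TransGen r) := Finite.wellFounded_of_trans_of_irrefl _
  exact Subrelation.wf (fun h => Relation.TransGen.single (r := r) h) hwf

theorem ne_source_of_mem_sinks (N : Network V E) {t : V} (ht : t ∈ N.sinks) : t ≠ N.source :=
  fun h => N.source_notMem_sinks (h ▸ ht)

namespace Code

variable [Fintype E] [DecidableEq E] [DecidableEq V] {N : Network V E}
variable {F : Type w} [Field F] {ω : ℕ}

/-- The matrix of the local coefficients `k_{d,e}` of pairs of real channels. -/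
def relay (c : N.Code F ω) : Matrix E E F :=
  Matrix.of fun d e => if h : N.head d = N.tail e then c.2 ⟨(d, e), h⟩ else 0

/-- The matrix of the local coefficients of the imaginary message channels. -/
def inject (c : N.Code F ω) : Matrix (Fin ω) E F :=
  Matrix.of fun i e => if h : N.tail e = N.source then c.1 ⟨(i, e), h⟩ else 0

/-- The error part of the extended global encoding kernels. -/
noncomputable def transfer (c : N.Code F ω) : Matrix E E F :=
  Matrix.of fun d e => c.extKernel e (Sum.inr d)

theorem relay_eq_zero (c : N.Code F ω) {d e : E} (h : ¬ N.Adj d e) : c.relay d e = 0 :=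
  dif_neg h

theorem extKernel_eq_sum_relay (c : N.Code F ω) (e : E) :
    c.extKernel e = (∑ i, c.inject i e • Pi.single (Sum.inl i) (1 : F))
      + (∑ d, c.relay d e • c.extKernel d) + Pi.single (Sum.inr e) (1 : F) := by
  rw [extKernel_eq]
  congr 2
  · by_cases h : N.tail e = N.source <;> simp [inject, h]
  · rw [← Fintype.sum_subtype_add_sum_subtype (fun d => N.head d = N.tail e)]
    rw [Finset.sum_eq_zero (s := (Finset.univ : Finset {d // ¬ N.head d = N.tail e})), add_zero]
    · exact Finset.sum_congr rfl fun d _ => by simp [relay, d.2]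
    · intro d _
      rw [c.relay_eq_zero d.2, zero_smul]

/-- The kernel recursion reads T = TK + 1. For square matrices the one-sided inverse is two-sided,
which also yields T = 1 + KT, the recursion along the first channel of a path. -/
theorem transfer_mul (c : N.Code F ω) : c.transfer * (1 - c.relay) = 1 := by
  ext d e
  have h := congrFun (c.extKernel_eq_sum_relay e) (Sum.inr d)
  rw [mul_sub, mul_one, Matrix.sub_apply, Matrix.mul_apply]
  simp only [transfer, Matrix.of_apply, h]
  simp [Matrix.one_apply, Pi.single_apply, mul_comm]

theorem mul_transfer (c : N.Code F ω) : (1 - c.relay) * c.transfer = 1 :=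
  mul_eq_one_comm.1 c.transfer_mul

theorem extKernel_inl (c : N.Code F ω) (i : Fin ω) (e : E) :
    c.extKernel e (Sum.inl i) = (c.inject * c.transfer) i e := by
  let M : Matrix (Fin ω) E F := Matrix.of fun i e => c.extKernel e (Sum.inl i)
  have hM : M * (1 - c.relay) = c.inject := by
    ext j d
    have h := congrFun (c.extKernel_eq_sum_relay d) (Sum.inl j)
    rw [Matrix.mul_sub, Matrix.mul_one, Matrix.sub_apply, Matrix.mul_apply]
    simp only [M, Matrix.of_apply, h]
    simp [Pi.single_apply, mul_comm]
  have : M = c.inject * c.transfer := by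
    rw [← hM, Matrix.mul_assoc, c.mul_transfer, Matrix.mul_one]
  exact congrFun (congrFun this i) e

/-- The symbols carried by the channels when `X` is sent and the error vector `Z` occurs. -/
noncomputable def signal (c : N.Code F ω) : ((Fin ω → F) × (E → F)) →ₗ[F] (E → F) :=
  c.transfer.vecMulLinear ∘ₗ c.inject.vecMulLinear.coprod LinearMap.id

theorem signal_apply (c : N.Code F ω) (v : (Fin ω → F) × (E → F)) :
    c.signal v = (v.1 ᵥ* c.inject + v.2) ᵥ* c.transfer := rfl

/-- Because 1 - K is invertible, the local balance equations have a unique solution, so a candidate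
signal can be identified by checking them channel by channel. -/
theorem eq_signal_iff (c : N.Code F ω) (v : (Fin ω → F) × (E → F)) (x : E → F) :
    x = c.signal v ↔ x = v.1 ᵥ* c.inject + v.2 + x ᵥ* c.relay := by
  rw [signal_apply, ← sub_eq_iff_eq_add]
  have h1 : x - x ᵥ* c.relay = x ᵥ* (1 - c.relay) := by
    rw [Matrix.vecMul_sub, Matrix.vecMul_one]
  rw [h1]
  constructor
  · intro h
    rw [h, Matrix.vecMul_vecMul, c.transfer_mul, Matrix.vecMul_one]
  · intro h
    rw [← h, Matrix.vecMul_vecMul, c.mul_transfer, Matrix.vecMul_one]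

theorem signal_eq (c : N.Code F ω) (v : (Fin ω → F) × (E → F)) :
    c.signal v = v.1 ᵥ* c.inject + v.2 + c.signal v ᵥ* c.relay :=
  (c.eq_signal_iff v _).1 rfl

theorem signal_eq_apply (c : N.Code F ω) (v : (Fin ω → F) × (E → F)) (e : E) :
    c.signal v e = ∑ i, v.1 i * c.inject i e + v.2 e + ∑ d, c.signal v d * c.relay d e :=
  congrFun (c.signal_eq v) e

/-- The part of the signal that arrives at `t`. -/
noncomputable def received (c : N.Code F ω) (t : V) :
    ((Fin ω → F) × (E → F)) →ₗ[F] ({e : E // N.head e = t} → F) :=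
  LinearMap.funLeft F F Subtype.val ∘ₗ c.signal

theorem received_apply (c : N.Code F ω) (t : V) (v : (Fin ω → F) × (E → F))
    (e : {e : E // N.head e = t}) : c.received t v e = c.signal v e.1 := rfl

theorem messageMatrix_vecMul (c : N.Code F ω) (t : V) (X : Fin ω → F) :
    X ᵥ* c.messageMatrix t = c.received t (X, 0) := by
  ext e
  rw [received_apply, signal_apply, add_zero, Matrix.vecMul_vecMul]
  simp only [Matrix.vecMul, dotProduct, messageMatrix, Matrix.of_apply, extKernel_inl]

theorem errorMatrix_vecMul (c : N.Code F ω) (t : V) (Z : E → F) :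
    Z ᵥ* c.errorMatrix t = c.received t (0, Z) := by
  ext e
  rw [received_apply, signal_apply, Matrix.zero_vecMul, zero_add]
  rfl

theorem received_eq_add (c : N.Code F ω) (t : V) (X : Fin ω → F) (Z : E → F) :
    c.received t (X, Z) = c.received t (X, 0) + c.received t (0, Z) := by
  rw [← map_add, Prod.mk_add_mk, add_zero, zero_add]

theorem mem_messageSpace (c : N.Code F ω) (t : V) (y : {e : E // N.head e = t} → F) :
    y ∈ c.messageSpace t ↔ ∃ X, c.received t (X, 0) = y := by
  simp only [messageSpace, LinearMap.mem_range, Matrix.vecMulLinear_apply, messageMatrix_vecMul]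

theorem mem_errorSpace (c : N.Code F ω) (t : V) (ρ : Finset E)
    (y : {e : E // N.head e = t} → F) :
    y ∈ c.errorSpace t ρ ↔ ∃ Z ∈ matching F ρ, c.received t (0, Z) = y := by
  simp only [errorSpace, Submodule.mem_map, Matrix.vecMulLinear_apply, errorMatrix_vecMul]

/-- The response at `t` to a unit error on the channel `d`. -/
noncomputable def response (c : N.Code F ω) (t : V) (d : E) : {e : E // N.head e = t} → F :=
  c.received t (0, Pi.single d 1)

theorem received_zero_eq_sum (c : N.Code F ω) (t : V) (Z : E → F) :
    c.received t (0, Z) = ∑ d, Z d • c.response t d := by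
  have h : ((0 : Fin ω → F), Z) = ∑ d, Z d • ((0 : Fin ω → F), (Pi.single d 1 : E → F)) := by
    apply Prod.ext
    · simp [Prod.fst_sum]
    · rw [Prod.snd_sum]
      ext e
      simp [Finset.sum_apply, Pi.single_apply]
  rw [h, map_sum]
  simp only [map_smul, response]

theorem response_mem_errorSpace (c : N.Code F ω) (t : V) {ρ : Finset E} {d : E} (hd : d ∈ ρ) :
    c.response t d ∈ c.errorSpace t ρ :=
  (c.mem_errorSpace t ρ _).2 ⟨Pi.single d 1, fun e he => by
    rw [Pi.single_eq_of_ne]; rintro rfl; exact he hd, rfl⟩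

theorem errorSpace_le_iff (c : N.Code F ω) (t : V) (ρ : Finset E)
    (M : Submodule F ({e : E // N.head e = t} → F)) :
    c.errorSpace t ρ ≤ M ↔ ∀ d ∈ ρ, c.response t d ∈ M := by
  refine ⟨fun h d hd => h (c.response_mem_errorSpace t hd), fun h y hy => ?_⟩
  obtain ⟨Z, hZ, rfl⟩ := (c.mem_errorSpace t ρ y).1 hy
  rw [received_zero_eq_sum]
  refine Submodule.sum_mem _ fun d _ => ?_
  by_cases hd : d ∈ ρ
  · exact M.smul_mem _ (h d hd)
  · rw [hZ d hd, zero_smul]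
    exact M.zero_mem

theorem errorSpace_mono (c : N.Code F ω) (t : V) {ρ₁ ρ₂ : Finset E} (h : ρ₁ ⊆ ρ₂) :
    c.errorSpace t ρ₁ ≤ c.errorSpace t ρ₂ :=
  (c.errorSpace_le_iff t _ _).2 fun _ hd => c.response_mem_errorSpace t (h hd)

theorem errorSpace_eq_span (c : N.Code F ω) (t : V) (ρ : Finset E) :
    c.errorSpace t ρ = Submodule.span F (c.response t '' ρ) := by
  apply le_antisymm
  · rw [errorSpace_le_iff]
    exact fun d hd => Submodule.subset_span ⟨d, hd, rfl⟩
  · rw [Submodule.span_le]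
    rintro _ ⟨d, hd, rfl⟩
    exact c.response_mem_errorSpace t hd

theorem finrank_errorSpace_le (c : N.Code F ω) (t : V) (ρ : Finset E) :
    Module.finrank F (c.errorSpace t ρ) ≤ ρ.card := by
  classical
  rw [errorSpace_eq_span, ← Finset.coe_image]
  exact (finrank_span_finset_le_card _).trans Finset.card_image_le

theorem errorSpace_union (c : N.Code F ω) (t : V) (ρ₁ ρ₂ : Finset E) :
    c.errorSpace t (ρ₁ ∪ ρ₂) = c.errorSpace t ρ₁ ⊔ c.errorSpace t ρ₂ := by
  simp only [errorSpace_eq_span, Finset.coe_union, Set.image_union, Submodule.span_union]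

/-- An error on a channel that does not end at t reaches t only through the channels that follow it:
this is T = 1 + KT read along row d. -/
theorem response_eq_sum (c : N.Code F ω) {t : V} {d : E} (hd : N.head d ≠ t) :
    c.response t d = ∑ e, c.relay d e • c.response t e := by
  have key : ∀ d e, c.signal (0, Pi.single d 1) e = c.transfer d e := fun d e => by
    rw [signal_apply, Matrix.zero_vecMul, zero_add, Matrix.single_one_vecMul]
    rfl
  ext a
  have h1 : c.transfer = 1 + c.relay * c.transfer := by
    have := c.mul_transfer
    rw [Matrix.sub_mul, Matrix.one_mul, sub_eq_iff_eq_add] at this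
    exact this
  have h2 := congrFun (congrFun h1 d) a.1
  have h3 : d ≠ a.1 := by rintro h; exact hd (h ▸ a.2)
  simp only [Finset.sum_apply, Pi.smul_apply, response, received_apply, key, smul_eq_mul]
  rw [h2, Matrix.add_apply, Matrix.one_apply_ne h3, zero_add, Matrix.mul_apply]

/-- If every channel that follows a channel of `S` lies in `S` or in `C`, then errors on `S` act at
`t` like errors on `C`. -/
theorem response_mem_errorSpace_of_closed (c : N.Code F ω) {t : V} {S C : Finset E}
    (hS : ∀ d ∈ S, N.head d ≠ t) (hC : ∀ d ∈ S, ∀ e, N.Adj d e → e ∈ S ∪ C) :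
    ∀ d ∈ S ∪ C, c.response t d ∈ c.errorSpace t C := by
  intro d
  induction d using N.flip_adj_wellFounded.induction with
  | _ d ih =>
    intro hd
    rcases Finset.mem_union.1 hd with h | h
    · rw [c.response_eq_sum (hS d h)]
      refine Submodule.sum_mem _ fun e _ => ?_
      by_cases hde : N.Adj d e
      · exact Submodule.smul_mem _ _ (ih e hde (hC d h e hde))
      · rw [c.relay_eq_zero hde, zero_smul]
        exact Submodule.zero_mem _
    · exact c.response_mem_errorSpace t h

/-- A message acts like an error vector on the channels leaving the source, and whatever flows from
there to t must cross the cut. -/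
theorem messageSpace_le_errorSpace (c : N.Code F ω) {t : V} {B : Finset E} (hB : N.IsCut t B) :
    c.messageSpace t ≤ c.errorSpace t B := by
  classical
  set r : V → V → Prop := fun a b => ∃ e, e ∉ B ∧ N.tail e = a ∧ N.head e = b with hr
  -- The channels on the source side of the cut; their successors stay in this set or lie in `B`.
  let S : Finset E := Finset.univ.filter fun e =>
    e ∉ B ∧ Relation.ReflTransGen r N.source (N.tail e)
  have hS : ∀ d ∈ S, N.head d ≠ t := by
    intro d hd ht
    obtain ⟨-, h1, h2⟩ := Finset.mem_filter.1 hd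
    exact hB (ht ▸ h2.tail ⟨d, h1, rfl, rfl⟩)
  have hclosed : ∀ d, Relation.ReflTransGen r N.source (N.tail d) → d ∈ S ∪ B := by
    intro d hd
    by_cases h : d ∈ B
    · exact Finset.mem_union_right _ h
    · exact Finset.mem_union_left _ (Finset.mem_filter.2 ⟨Finset.mem_univ _, h, hd⟩)
  have key := c.response_mem_errorSpace_of_closed (t := t) (S := S) (C := B) hS (by
    intro d hd e hde
    obtain ⟨-, h1, h2⟩ := Finset.mem_filter.1 hd
    exact hclosed e (hde ▸ h2.tail ⟨d, h1, rfl, rfl⟩))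
  intro y hy
  obtain ⟨X, rfl⟩ := (c.mem_messageSpace t y).1 hy
  have : c.received t (X, 0) = c.received t (0, X ᵥ* c.inject) := by
    ext a
    simp only [received_apply, signal_apply, add_zero, Matrix.zero_vecMul, zero_add]
  rw [this, received_zero_eq_sum]
  refine Submodule.sum_mem _ fun d _ => ?_
  by_cases hd : N.tail d = N.source
  · exact Submodule.smul_mem _ _ (key d (hclosed d (hd ▸ .refl)))
  · have : (X ᵥ* c.inject) d = 0 := by
      simp [Matrix.vecMul, dotProduct, inject, hd]
    rw [this, zero_smul]
    exact Submodule.zero_mem _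

end Code

end Network

/-! ### Rank of error patterns, decodability and the Singleton bound -/

namespace Network

open Matrix

variable {V : Type u} {E : Type v}

section Rank

variable [Fintype E] [DecidableEq E] [DecidableEq V]
variable (N : Network V E) (F : Type w) [Field F]

theorem exists_dominated_card_eq_rank (t : V) (ρ : Finset E) :
    ∃ ρ' : Finset E, N.Dominated F t ρ ρ' ∧ ρ'.card = N.rank F t ρ :=
  Nat.sInf_mem (s := {n | ∃ ρ' : Finset E, N.Dominated F t ρ ρ' ∧ ρ'.card = n})
    ⟨ρ.card, ρ, fun _ _ => le_rfl, rfl⟩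

variable {N F}

theorem Dominated.trans {t : V} {ρ₁ ρ₂ ρ₃ : Finset E} (h₁ : N.Dominated F t ρ₁ ρ₂)
    (h₂ : N.Dominated F t ρ₂ ρ₃) : N.Dominated F t ρ₁ ρ₃ :=
  fun m c => (h₁ m c).trans (h₂ m c)

theorem Dominated.of_subset {t : V} {ρ₁ ρ₂ : Finset E} (h : ρ₁ ⊆ ρ₂) : N.Dominated F t ρ₁ ρ₂ :=
  fun _ c => c.errorSpace_mono t h

theorem Dominated.rank_le {t : V} {ρ₁ ρ₂ : Finset E} (h : N.Dominated F t ρ₁ ρ₂) :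
    N.rank F t ρ₁ ≤ ρ₂.card :=
  Nat.sInf_le ⟨ρ₂, h, rfl⟩

theorem rank_le_card (t : V) (ρ : Finset E) : N.rank F t ρ ≤ ρ.card :=
  Dominated.rank_le (.of_subset subset_rfl)

theorem finrank_errorSpace_le_rank {ω : ℕ} (c : N.Code F ω) (t : V) (ρ : Finset E) :
    Module.finrank F (c.errorSpace t ρ) ≤ N.rank F t ρ := by
  obtain ⟨ρ', h, hc⟩ := N.exists_dominated_card_eq_rank F t ρ
  rw [← hc]
  exact (Submodule.finrank_mono (h ω c)).trans (c.finrank_errorSpace_le t ρ')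

/-- A dominating pattern of least size cannot itself be dominated by a smaller one, by transitivity.
-/
theorem exists_dominated_rank_eq_card (t : V) (ρ : Finset E) :
    ∃ ρ' : Finset E, N.Dominated F t ρ ρ' ∧ N.rank F t ρ' = ρ'.card ∧
      ρ'.card = N.rank F t ρ := by
  obtain ⟨ρ', h, hc⟩ := N.exists_dominated_card_eq_rank F t ρ
  obtain ⟨ρ'', h', hc'⟩ := N.exists_dominated_card_eq_rank F t ρ'
  refine ⟨ρ', h, le_antisymm (rank_le_card t ρ') ?_, hc⟩
  rw [hc, ← hc']
  exact (h.trans h').rank_le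

theorem isCut_univ {t : V} (ht : t ≠ N.source) : N.IsCut t Finset.univ := by
  intro h
  rcases h.cases_tail with h | ⟨_, -, e, he, -⟩
  · exact ht h
  · exact he (Finset.mem_univ e)

theorem minCut_le {t : V} {B : Finset E} (hB : N.IsCut t B) : N.minCut t ≤ B.card :=
  Nat.sInf_le ⟨B, hB, rfl⟩

theorem exists_isCut_card_eq_minCut {t : V} (ht : t ≠ N.source) :
    ∃ B : Finset E, N.IsCut t B ∧ B.card = N.minCut t :=
  Nat.sInf_mem (s := {n | ∃ B : Finset E, N.IsCut t B ∧ B.card = n})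
    ⟨_, Finset.univ, isCut_univ ht, rfl⟩

end Rank

namespace Code

variable [Fintype E] [DecidableEq E] [DecidableEq V] {N : Network V E}
variable {F : Type w} [Field F] {ω : ℕ}

/-- The sink `t` can decode the message and every error vector that matches `ρ`. -/
def Decodable (c : N.Code F ω) (t : V) (ρ : Finset E) : Prop :=
  ∀ X, ∀ Z ∈ matching F ρ, c.received t (X, Z) = 0 → X = 0 ∧ Z = 0

theorem finrank_messageSpace (c : N.Code F ω) (t : V)
    (h : ∀ X, c.received t (X, 0) = 0 → X = 0) : Module.finrank F (c.messageSpace t) = ω := by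
  rw [messageSpace, LinearMap.finrank_range_of_inj, Module.finrank_fin_fun]
  rw [injective_iff_map_eq_zero]
  intro X hX
  rw [Matrix.vecMulLinear_apply, messageMatrix_vecMul] at hX
  exact h X hX

theorem received_eq_zero_iff (c : N.Code F ω) (t : V)
    (h : Module.finrank F (c.messageSpace t) = ω) (X : Fin ω → F) :
    c.received t (X, 0) = 0 ↔ X = 0 := by
  have hinj : Function.Injective (c.messageMatrix t).vecMulLinear := by
    rw [← LinearMap.ker_eq_bot, ← Submodule.finrank_eq_zero]
    have h1 := LinearMap.finrank_range_add_finrank_ker (c.messageMatrix t).vecMulLinear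
    rw [Module.finrank_fin_fun] at h1
    rw [messageSpace] at h
    omega
  rw [← messageMatrix_vecMul, ← Matrix.vecMulLinear_apply]
  exact map_eq_zero_iff _ hinj

theorem Decodable.finrank_messageSpace {c : N.Code F ω} {t : V} {ρ : Finset E}
    (h : c.Decodable t ρ) : Module.finrank F (c.messageSpace t) = ω :=
  c.finrank_messageSpace t fun X hX => (h X 0 (Submodule.zero_mem _) hX).1

theorem Decodable.inf_eq_bot {c : N.Code F ω} {t : V} {ρ : Finset E}
    (h : c.Decodable t ρ) : c.errorSpace t ρ ⊓ c.messageSpace t = ⊥ := by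
  rw [Submodule.eq_bot_iff]
  rintro y ⟨hy1, hy2⟩
  obtain ⟨Z, hZ, rfl⟩ := (c.mem_errorSpace t ρ y).1 hy1
  obtain ⟨X, hX⟩ := (c.mem_messageSpace t _).1 hy2
  have := h (-X) Z hZ (by
    rw [received_eq_add, ← hX, ← map_add, Prod.mk_add_mk, neg_add_cancel, add_zero]
    exact map_zero _)
  rw [this.2]
  exact map_zero _

theorem Decodable.finrank_errorSpace {c : N.Code F ω} {t : V} {ρ : Finset E}
    (h : c.Decodable t ρ) : Module.finrank F (c.errorSpace t ρ) = ρ.card := by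
  have hli : LinearIndependent F fun d : ρ => c.response t d := by
    rw [Fintype.linearIndependent_iff]
    intro g hg d
    let Z : E → F := fun e => if h : e ∈ ρ then g ⟨e, h⟩ else 0
    have hZ : Z ∈ matching F ρ := fun e he => dif_neg he
    have h0 : c.received t (0, Z) = 0 := by
      rw [received_zero_eq_sum, ← hg, ← Finset.sum_subset (Finset.subset_univ ρ),
        ← Finset.sum_coe_sort]
      · exact Finset.sum_congr rfl fun d _ => by simp [Z]
      · intro d _ hd
        simp [Z, hd]
    have := congrFun (h 0 Z hZ h0).2 d.1
    simpa [Z] using this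
  have h1 : c.errorSpace t ρ = Submodule.span F (Set.range fun d : ρ => c.response t d) := by
    rw [errorSpace_eq_span, Set.image_eq_range]
    rfl
  rw [h1, finrank_span_eq_card hli, Fintype.card_coe]

/-- The network counterpart of Menger's theorem: a set of channels `ρ` of full rank and `ω` messages
can be delivered to `t` together. -/
theorem exists_decodable {t : V} (ht : t ≠ N.source) {ρ : Finset E}
    (hρ : N.rank F t ρ = ρ.card) (hω : ω + ρ.card ≤ N.minCut t) :
    ∃ c : N.Code F ω, c.Decodable t ρ := by
  classical
  let out : Finset E := Finset.univ.filter fun e => N.tail e = N.source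
  -- Every message is to be assigned a channel leaving the source, and every channel not ending at t
  -- either a successor or itself, injectively and avoiding `ρ`. Being assigned to itself means that
  -- the channel is not forwarded.
  let nbr : Fin ω ⊕ {e : E // N.head e ≠ t} → Finset E :=
    Sum.elim (fun _ => out \ ρ) (fun d => (Finset.univ.filter fun e => e = d.1 ∨ N.Adj d.1 e) \ ρ)
  have hall : ∀ s : Finset (Fin ω ⊕ {e : E // N.head e ≠ t}),
      s.card ≤ (s.biUnion nbr).card := by
    intro s
    let S : Finset E := s.toRight.map (Function.Embedding.subtype _)
    let M : Finset E := Finset.univ.filter fun e => e ∈ S ∨ ∃ d ∈ S, N.Adj d e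
    have hSt : ∀ d ∈ S, N.head d ≠ t := by
      intro d hd
      obtain ⟨d', -, rfl⟩ := Finset.mem_map.1 hd
      exact d'.2
    have hSM : S ⊆ M := fun e he => Finset.mem_filter.2 ⟨Finset.mem_univ _, Or.inl he⟩
    have hMS : ∀ d ∈ S, ∀ e, N.Adj d e → e ∈ M := fun d hd e hde =>
      Finset.mem_filter.2 ⟨Finset.mem_univ _, Or.inr ⟨d, hd, hde⟩⟩
    have hS : s.toRight.card = S.card := (Finset.card_map _).symm
    have hcard := Finset.card_toLeft_add_card_toRight (u := s)
    have hMs : M \ ρ ⊆ s.biUnion nbr := by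
      intro e he
      obtain ⟨he1, he2⟩ := Finset.mem_sdiff.1 he
      have : ∃ d ∈ S, e = d ∨ N.Adj d e := by
        rcases (Finset.mem_filter.1 he1).2 with h | ⟨d, hd, hde⟩
        · exact ⟨e, h, Or.inl rfl⟩
        · exact ⟨d, hd, Or.inr hde⟩
      obtain ⟨d, hd, hde⟩ := this
      obtain ⟨d', hd', rfl⟩ := Finset.mem_map.1 hd
      refine Finset.mem_biUnion.2 ⟨Sum.inr d', Finset.mem_toRight.1 hd', ?_⟩
      exact Finset.mem_sdiff.2 ⟨Finset.mem_filter.2 ⟨Finset.mem_univ _, hde⟩, he2⟩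
    rcases s.toLeft.eq_empty_or_nonempty with hl | ⟨j, hj⟩
    -- Without messages, Hall's condition comes from the rank: errors on `S` can be pushed to the
    -- rest of `M`, so full rank of `ρ` gives |ρ| ≤ |M ∪ ρ| - |S|, that is, |S| ≤ |M \ ρ|.
    · have hdom : N.Dominated F t ρ ((M ∪ ρ) \ S) := by
        intro m c
        rw [errorSpace_le_iff]
        intro d hd
        refine c.response_mem_errorSpace_of_closed hSt (C := (M ∪ ρ) \ S) ?_ d ?_
        · intro d hd e hde
          by_cases h : e ∈ S
          · exact Finset.mem_union_left _ h
          · exact Finset.mem_union_right _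
              (Finset.mem_sdiff.2 ⟨Finset.mem_union_left _ (hMS d hd e hde), h⟩)
        · by_cases h : d ∈ S
          · exact Finset.mem_union_left _ h
          · exact Finset.mem_union_right _
              (Finset.mem_sdiff.2 ⟨Finset.mem_union_right _ hd, h⟩)
      have h1 := hdom.rank_le
      rw [hρ, Finset.card_sdiff_of_subset (hSM.trans Finset.subset_union_left)] at h1
      have h2 := Finset.card_sdiff_add_card M ρ
      have h3 := Finset.card_le_card (hSM.trans (Finset.subset_union_left (s₂ := ρ)))
      have h4 := Finset.card_le_card hMs
      rw [hl, Finset.card_empty] at hcard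
      omega
    · have hMout : (M ∪ out) \ ρ ⊆ s.biUnion nbr := by
        rw [Finset.union_sdiff_distrib]
        refine Finset.union_subset hMs fun e he => ?_
        exact Finset.mem_biUnion.2 ⟨Sum.inl j, Finset.mem_toLeft.1 hj, he⟩
      -- With a message present, Hall's condition comes from the cut: minCut ≤ |M ∪ out| - |S|, and
      -- `hω` leaves room for `ρ` and all ω messages.
      have hcut : N.IsCut t ((M ∪ out) \ S) := by
        intro h
        have key : ∀ v, Relation.ReflTransGen
            (fun a b => ∃ e, e ∉ (M ∪ out) \ S ∧ N.tail e = a ∧ N.head e = b) N.source v →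
            v = N.source ∨ ∃ d ∈ S, N.head d = v := by
          intro v hv
          induction hv with
          | refl => exact Or.inl rfl
          | tail _ hbc ih =>
            obtain ⟨e, he, rfl, rfl⟩ := hbc
            refine Or.inr ⟨e, ?_, rfl⟩
            by_contra heS
            apply he
            refine Finset.mem_sdiff.2 ⟨?_, heS⟩
            rcases ih with h | ⟨d, hd, hde⟩
            · exact Finset.mem_union_right _ (Finset.mem_filter.2 ⟨Finset.mem_univ _, h⟩)
            · exact Finset.mem_union_left _ (hMS d hd e hde)
        rcases key t h with h | ⟨d, hd, hdt⟩
        · exact ht h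
        · exact hSt d hd hdt
      have h1 := minCut_le hcut
      rw [Finset.card_sdiff_of_subset (hSM.trans Finset.subset_union_left)] at h1
      have h2 := Finset.le_card_sdiff ρ (M ∪ out)
      have h3 := Finset.card_le_card (hSM.trans (Finset.subset_union_left (s₂ := out)))
      have h4 := Finset.card_le_card hMout
      have h5 : s.toLeft.card ≤ ω := by simpa using Finset.card_le_univ s.toLeft
      have h6 : 0 < s.toLeft.card := Finset.card_pos.2 ⟨j, hj⟩
      omega
  obtain ⟨f, hf, hfn⟩ := (Finset.all_card_le_biUnion_card_iff_exists_injective nbr).1 hall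
  let c : N.Code F ω := (fun p => if f (Sum.inl p.1.1) = p.1.2 then 1 else 0,
    fun p => if h : N.head p.1.1 ≠ t then if f (Sum.inr ⟨p.1.1, h⟩) = p.1.2 then 1 else 0 else 0)
  have hinj : ∀ i e, c.inject i e = if f (Sum.inl i) = e then 1 else 0 := by
    intro i e
    by_cases h : N.tail e = N.source
    · simp [inject, h, c]
    · have : f (Sum.inl i) ≠ e := by
        rintro rfl
        exact h (Finset.mem_filter.1 (Finset.mem_sdiff.1 (hfn (Sum.inl i))).1).2
      simp [inject, h, this]
  have hrel : ∀ d (h : N.head d ≠ t) e, e ≠ d →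
      c.relay d e = if f (Sum.inr ⟨d, h⟩) = e then 1 else 0 := by
    intro d h e hed
    by_cases hde : N.head d = N.tail e
    · simp only [relay, Matrix.of_apply, hde, dif_pos, c]
      rw [dif_pos (by rwa [← hde])]
    · have : f (Sum.inr ⟨d, h⟩) ≠ e := by
        rintro rfl
        rcases (Finset.mem_filter.1 (Finset.mem_sdiff.1 (hfn (Sum.inr ⟨d, h⟩))).1).2 with h' | h'
        · exact hed h'
        · exact hde h'
      simp [relay, hde, this]
  have hnot : ∀ a, f a ∉ ρ := by
    rintro (i | d)
    · exact (Finset.mem_sdiff.1 (hfn (Sum.inl i))).2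
    · exact (Finset.mem_sdiff.1 (hfn (Sum.inr d))).2
  refine ⟨c, fun X Z hZ hr => ?_⟩
  have hx0 : ∀ d, N.head d = t → c.signal (X, Z) d = 0 := fun d hd => congrFun hr ⟨d, hd⟩
  have hsum_inj : ∀ a e, f a = e → (∀ i, a ≠ Sum.inl i) → ∑ i, X i * c.inject i e = 0 := by
    intro a e hae ha
    refine Finset.sum_eq_zero fun i _ => ?_
    rw [hinj, if_neg, mul_zero]
    intro h
    exact ha i (hf (hae.trans h.symm))
  have hterm : ∀ a e, f a = e → ∀ d, (∀ h, a ≠ Sum.inr ⟨d, h⟩) →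
      c.signal (X, Z) d * c.relay d e = 0 := by
    intro a e hae d had
    by_cases h : N.head d = t
    · rw [hx0 d h, zero_mul]
    · by_cases hed : e = d
      · rw [hed, c.relay_eq_zero (N.not_adj_self d), mul_zero]
      · rw [hrel d h e hed, if_neg fun h' => had h (hf (hae.trans h'.symm)), mul_zero]
  -- Suppose nothing is received. At the channel `e` assigned to `d`, injectivity removes every
  -- other contribution and `e ∉ ρ` removes the error. So the symbol on `d` equals the one on `e`,
  -- already zero by downstream induction, or, if `e = d`, it is zero outright.
  have hx : ∀ d, c.signal (X, Z) d = 0 := by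
    intro d
    induction d using N.flip_adj_wellFounded.induction with
    | _ d ih =>
      by_cases hd : N.head d = t
      · exact hx0 d hd
      · have hmem := (Finset.mem_filter.1 (Finset.mem_sdiff.1 (hfn (Sum.inr ⟨d, hd⟩))).1).2
        obtain ⟨e, he⟩ : ∃ e, f (Sum.inr ⟨d, hd⟩) = e := ⟨_, rfl⟩
        have hZe : Z e = 0 := hZ e (he ▸ hnot _)
        rw [he] at hmem
        have hse : c.signal (X, Z) e = c.signal (X, Z) d * c.relay d e := by
          rw [c.signal_eq_apply (X, Z) e, hsum_inj _ e he (by simp), zero_add]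
          change Z e + _ = _
          rw [hZe, zero_add]
          refine Finset.sum_eq_single d (fun d' _ hd' => hterm _ e he d' fun h h' => ?_) (by simp)
          exact hd' (congrArg Subtype.val (Sum.inr.inj h')).symm
        by_cases hed : e = d
        · rw [hed, c.relay_eq_zero (N.not_adj_self d), mul_zero] at hse
          exact hse
        · rw [hrel d hd e hed, if_pos he, mul_one] at hse
          rw [← hse]
          exact ih e (hmem.resolve_left hed)
  have hX : X = 0 := by
    ext i
    obtain ⟨e, he⟩ : ∃ e, f (Sum.inl i) = e := ⟨_, rfl⟩
    have hZe : Z e = 0 := hZ e (he ▸ hnot _)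
    have hse := c.signal_eq_apply (X, Z) e
    rw [hx e, Finset.sum_eq_zero fun d _ => hterm _ e he d (by simp), add_zero] at hse
    change 0 = _ + Z e at hse
    rw [hZe, add_zero] at hse
    rw [Pi.zero_apply, hse]
    refine ((Finset.sum_eq_single i (fun j _ hj => ?_) (by simp)).trans ?_).symm
    · rw [hinj, if_neg fun h => hj (Sum.inl.inj (hf (h.trans he.symm))), mul_zero]
    · rw [hinj, if_pos he, mul_one]
  refine ⟨hX, ?_⟩
  have hs := c.signal_eq (X, Z)
  have hx' : c.signal (X, Z) = 0 := funext hx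
  rw [hx', hX, Matrix.zero_vecMul, Matrix.zero_vecMul, zero_add, add_zero] at hs
  exact hs.symm

/-- Below the min cut there is room for one extra message besides `ρ`. A code decoding both cannot
have all its responses in the error space of `ρ`, since these span a space containing the message
space. A channel with response outside raises the dimension, hence the rank. -/
theorem exists_rank_insert_eq {t : V} (ht : t ≠ N.source) {ρ : Finset E}
    (hρ : N.rank F t ρ = ρ.card) (hω : ρ.card < N.minCut t) :
    ∃ e, e ∉ ρ ∧ N.rank F t (insert e ρ) = (insert e ρ).card := by
  obtain ⟨c, hc⟩ := exists_decodable (ω := 1) ht hρ (by omega)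
  have hex : ∃ e, c.response t e ∉ c.errorSpace t ρ := by
    by_contra! h
    have h1 : c.messageSpace t ≤ c.errorSpace t ρ :=
      (c.messageSpace_le_errorSpace (isCut_univ ht)).trans
        ((c.errorSpace_le_iff t _ _).2 fun d _ => h d)
    have h2 := hc.inf_eq_bot
    rw [inf_eq_right.2 h1] at h2
    have h3 := hc.finrank_messageSpace
    rw [h2, finrank_bot] at h3
    exact zero_ne_one h3
  obtain ⟨e, he⟩ := hex
  have heρ : e ∉ ρ := fun h => he (c.response_mem_errorSpace t h)
  refine ⟨e, heρ, le_antisymm (rank_le_card t _) ?_⟩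
  have hlt : c.errorSpace t ρ < c.errorSpace t (insert e ρ) :=
    lt_of_le_of_ne (c.errorSpace_mono t (Finset.subset_insert e ρ)) fun h =>
      he (h ▸ c.response_mem_errorSpace t (Finset.mem_insert_self e ρ))
  have h1 := Submodule.finrank_lt_finrank_of_lt hlt
  rw [hc.finrank_errorSpace] at h1
  rw [Finset.card_insert_of_notMem heρ]
  exact Nat.succ_le_of_lt (h1.trans_le (finrank_errorSpace_le_rank c t _))

-- Replace `ρ` by a dominating pattern of full rank, then enlarge it one channel at a time, keeping
-- full rank, until its size is `δ`.
variable (F) in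
theorem exists_dominated_mem_R {t : V} (ht : t ≠ N.source) {δ : ℕ} (hδ : δ ≤ N.minCut t)
    {ρ : Finset E} (hρ : N.rank F t ρ ≤ δ) :
    ∃ ρ' ∈ N.R F t δ, N.Dominated F t ρ ρ' := by
  suffices h : ∀ n, ∀ ρ : Finset E, N.rank F t ρ = ρ.card → ρ.card + n = δ →
      ∃ ρ' ∈ N.R F t δ, N.Dominated F t ρ ρ' by
    obtain ⟨ρ₁, h₁, h₂, h₃⟩ := N.exists_dominated_rank_eq_card (F := F) t ρ
    obtain ⟨ρ', h', h''⟩ := h (δ - ρ₁.card) ρ₁ h₂ (by omega)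
    exact ⟨ρ', h', h₁.trans h''⟩
  intro n
  induction n with
  | zero =>
    intro ρ h₁ h₂
    exact ⟨ρ, Finset.mem_filter.2 ⟨Finset.mem_univ _, h₂, h₁.trans h₂⟩, .of_subset subset_rfl⟩
  | succ n ih =>
    intro ρ h₁ h₂
    obtain ⟨e, he, hr⟩ := exists_rank_insert_eq ht h₁ (by omega)
    obtain ⟨ρ', h', h''⟩ := ih _ hr (by rw [Finset.card_insert_of_notMem he]; omega)
    exact ⟨ρ', h', (Dominated.of_subset (Finset.subset_insert e ρ)).trans h''⟩

theorem finrank_pos_iff_ne_bot {M : Type*} [AddCommGroup M] [Module F M] [Module.Finite F M]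
    (S : Submodule F M) : 0 < Module.finrank F S ↔ S ≠ ⊥ := by
  rw [Nat.pos_iff_ne_zero, Ne, Submodule.finrank_eq_zero]

/-- The Singleton bound. -/
theorem exists_singleton (c : N.Code F ω) {t : V} (ht : t ≠ N.source) (hω : 1 ≤ ω)
    (hcut : ω ≤ N.minCut t) (hreg : Module.finrank F (c.messageSpace t) = ω) :
    ∃ ρ : Finset E, ρ.card + ω = N.minCut t + 1 ∧
      c.errorSpace t ρ ⊓ c.messageSpace t ≠ ⊥ := by
  obtain ⟨B, hB, hcard⟩ := N.exists_isCut_card_eq_minCut ht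
  -- All but ω - 1 channels of a minimum cut: the omitted ones add at most ω - 1 dimensions, too few
  -- for an ω-dimensional message space independent of the error space of `ρ`.
  obtain ⟨ρ, hρB, hρ⟩ := Finset.exists_subset_card_eq (s := B) (n := N.minCut t + 1 - ω) (by omega)
  refine ⟨ρ, by omega, fun hbot => ?_⟩
  have h1 := Submodule.finrank_sup_add_finrank_inf_eq (c.errorSpace t ρ) (c.messageSpace t)
  rw [hbot, finrank_bot, hreg] at h1
  have h2 : c.errorSpace t ρ ⊔ c.messageSpace t ≤ c.errorSpace t ρ ⊔ c.errorSpace t (B \ ρ) := by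
    rw [← errorSpace_union, Finset.union_sdiff_of_subset hρB]
    exact sup_le (c.errorSpace_mono t hρB) (c.messageSpace_le_errorSpace hB)
  have h3 := Submodule.finrank_mono h2
  have h4 := Submodule.finrank_add_le_finrank_add_finrank (c.errorSpace t ρ) (c.errorSpace t (B \ ρ))
  have h5 := c.finrank_errorSpace_le t (B \ ρ)
  rw [Finset.card_sdiff_of_subset hρB] at h5
  omega

theorem minDist_le (c : N.Code F ω) {t : V} {ρ : Finset E}
    (h : c.errorSpace t ρ ⊓ c.messageSpace t ≠ ⊥) : c.minDist t ≤ N.rank F t ρ :=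
  Nat.sInf_le ⟨ρ, (finrank_pos_iff_ne_bot _).2 h, rfl⟩

theorem minDist_add_eq (c : N.Code F ω) {t : V} (ht : t ≠ N.source) (hω : 1 ≤ ω)
    (hcut : ω ≤ N.minCut t) (hreg : Module.finrank F (c.messageSpace t) = ω)
    (h : ∀ ρ, N.rank F t ρ ≤ N.redundancy ω t → c.errorSpace t ρ ⊓ c.messageSpace t = ⊥) :
    c.minDist t + ω = N.minCut t + 1 := by
  obtain ⟨ρ, hρ, hne⟩ := c.exists_singleton ht hω hcut hreg
  have h1 := (c.minDist_le hne).trans (rank_le_card t ρ)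
  obtain ⟨ρ', hρ', hr⟩ := Nat.sInf_mem (s := {n | ∃ ρ : Finset E,
    0 < Module.finrank F ↥(c.errorSpace t ρ ⊓ c.messageSpace t) ∧ N.rank F t ρ = n})
    ⟨_, ρ, (finrank_pos_iff_ne_bot _).2 hne, rfl⟩
  change N.rank F t ρ' = c.minDist t at hr
  by_contra hcon
  refine (finrank_pos_iff_ne_bot _).1 hρ' (h ρ' ?_)
  rw [hr, redundancy]
  omega

/-- Domination passes trivial intersection from patterns in R_t(δ_t) to all patterns of rank at most
δ_t. Regularity uses that R_t(δ_t) is nonempty, since it contains a pattern dominating ∅. -/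
theorem isMDS_of_decodable (hω : 1 ≤ ω) (hcut : ∀ t ∈ N.sinks, ω ≤ N.minCut t)
    (c : N.Code F ω)
    (h : ∀ t ∈ N.sinks, ∀ ρ ∈ N.R F t (N.redundancy ω t), c.Decodable t ρ) : c.IsMDS := by
  have hreg : c.IsRegular := by
    intro t ht
    obtain ⟨ρ, hρ, -⟩ := exists_dominated_mem_R F (N.ne_source_of_mem_sinks ht)
      (δ := N.redundancy ω t) (Nat.sub_le _ _) (ρ := ∅)
      ((rank_le_card t ∅).trans (by simp))
    exact (h t ht ρ hρ).finrank_messageSpace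
  refine ⟨hreg, fun t ht => ?_⟩
  refine c.minDist_add_eq (N.ne_source_of_mem_sinks ht) hω (hcut t ht) (hreg t ht) fun ρ hρ => ?_
  obtain ⟨ρ', hρ', hdom⟩ := exists_dominated_mem_R F (N.ne_source_of_mem_sinks ht)
    (δ := N.redundancy ω t) (Nat.sub_le _ _) hρ
  rw [eq_bot_iff, ← (h t ht ρ' hρ').inf_eq_bot]
  exact inf_le_inf_right _ (hdom ω c)

end Code

end Network

/-! ### Counting over finite vector spaces and block-by-block exposure -/

section Counting

open Classical in
/-- The nonempty fibers of a linear map between finite spaces have size `|Ω| / |range|`. -/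
theorem LinearMap.card_range_mul_card_fiber_le {F Ω Y : Type*} [Field F] [AddCommGroup Ω]
    [Module F Ω] [Fintype Ω] [AddCommGroup Y] [Module F Y] (f : Ω →ₗ[F] Y) (y : Y) :
    Nat.card (LinearMap.range f) * (Finset.univ.filter fun z => f z = y).card ≤
      Fintype.card Ω := by
  have : Finite (LinearMap.range f) := Finite.of_surjective _ f.surjective_rangeRestrict
  have := Fintype.ofFinite (LinearMap.range f)
  choose s hs using f.surjective_rangeRestrict
  have hs' : ∀ r, f (s r) = r.1 := fun r => congrArg Subtype.val (hs r)
  rw [Nat.card_eq_fintype_card, ← Finset.card_univ, ← Finset.card_product, ← Finset.card_univ]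
  -- Translating the fiber by a chosen preimage of each point of the range gives disjoint copies of
  -- it.
  refine Finset.card_le_card_of_injOn (fun p => p.2 + s p.1) (fun _ _ => Finset.mem_coe.2
    (Finset.mem_univ _)) ?_
  rintro ⟨r₁, z₁⟩ h₁ ⟨r₂, z₂⟩ h₂ h
  have h₁' : f z₁ = y := by simpa using h₁
  have h₂' : f z₂ = y := by simpa using h₂
  have h' := congrArg f h
  simp only [map_add, hs', h₁', h₂', add_right_inj] at h'
  have hr : r₁ = r₂ := Subtype.ext h'
  subst hr
  exact Prod.ext rfl (add_right_cancel h)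

open Classical in
/-- If `v ↦ a v + b v z` is injective for some `z` and the maps `b v` are zero or have a common
range, then it fails to be injective for at most `|Ω| / (|F| - 1)` of the `z ∈ Ω`. -/
theorem LinearMap.card_not_injective_le {F Ω W Y : Type*} [Field F] [Fintype F]
    [AddCommGroup Ω] [Module F Ω] [Fintype Ω] [AddCommGroup W] [Module F W] [Fintype W]
    [AddCommGroup Y] [Module F Y] (a : W →ₗ[F] Y) (b : W →ₗ[F] Ω →ₗ[F] Y) (R : Submodule F Y)
    [Finite R] (hb : ∀ v, b v = 0 ∨ LinearMap.range (b v) = R) (z₀ : Ω)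
    (h₀ : ∀ v, a v + b v z₀ = 0 → v = 0) :
    (Fintype.card F - 1) * (Finset.univ.filter fun z => ¬ ∀ v, a v + b v z = 0 → v = 0).card ≤
      Fintype.card Ω := by
  have := Fintype.ofFinite R
  have hbR : ∀ v z, b v z ∈ R := by
    intro v z
    rcases hb v with h | h
    · rw [h]; exact R.zero_mem
    · rw [← h]; exact ⟨z, rfl⟩
  set bad := Finset.univ.filter fun z => ¬ ∀ v, a v + b v z = 0 → v = 0
  -- Only such `v` can lie in a kernel, as `b v z` is always in `R`. Injectivity at `z₀` embeds `U`
  -- into `R`.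
  let U : Finset W := Finset.univ.filter fun v => a v ∈ R
  have hU : U.card ≤ Nat.card R := by
    rw [Nat.card_eq_fintype_card, ← Fintype.card_coe]
    refine Fintype.card_le_of_injective (fun v : U => (⟨a v.1 + b v.1 z₀,
      R.add_mem (Finset.mem_filter.1 v.2).2 (hbR _ _)⟩ : R)) ?_
    intro v₁ v₂ h
    have h' := congrArg Subtype.val h
    simp only at h'
    have := h₀ (v₁.1 - v₂.1) (by
      rw [map_sub, map_sub, LinearMap.sub_apply, ← sub_eq_zero.2 h']
      abel)
    exact Subtype.ext (sub_eq_zero.1 this)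
  -- A nonzero kernel vector brings its |F| - 1 nonzero multiples; this is the source of the
  -- denominator |F| - 1.
  have hlow : ∀ z ∈ bad, Fintype.card F - 1 ≤
      ((U.erase 0).filter fun v => a v + b v z = 0).card := by
    intro z hz
    obtain ⟨v, hv, hv0⟩ : ∃ v, a v + b v z = 0 ∧ v ≠ 0 := by
      simpa [bad] using hz
    rw [← Finset.card_univ, ← Finset.card_erase_of_mem (Finset.mem_univ (0 : F))]
    refine Finset.card_le_card_of_injOn (fun r => r • v) ?_
      ((smul_left_injective F hv0).injOn)
    intro r hr
    have hr0 : r ≠ 0 := by simpa using hr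
    have hker : a (r • v) + b (r • v) z = 0 := by
      rw [map_smul, map_smul, LinearMap.smul_apply, ← smul_add, hv, smul_zero]
    refine Finset.mem_coe.2 (Finset.mem_filter.2 ⟨Finset.mem_erase.2 ⟨smul_ne_zero hr0 hv0,
      Finset.mem_filter.2 ⟨Finset.mem_univ _, ?_⟩⟩, hker⟩)
    rw [eq_neg_of_add_eq_zero_left hker]
    exact R.neg_mem (hbR _ _)
  -- Each nonzero `v` is killed by at most |Ω| / |R| of the `z`; if `b v = 0`, by none, since then
  -- `z₀` would be bad as well.
  have hup : ∀ v ∈ U.erase 0,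
      Nat.card R * (bad.filter fun z => a v + b v z = 0).card ≤ Fintype.card Ω := by
    intro v hv
    have hv0 : v ≠ 0 := (Finset.mem_erase.1 hv).1
    rcases hb v with h | h
    · rw [Finset.filter_false_of_mem, Finset.card_empty, mul_zero]
      · exact Nat.zero_le _
      · intro z _ hz
        apply hv0
        apply h₀
        rw [h, LinearMap.zero_apply] at hz ⊢
        exact hz
    · rw [← h]
      refine le_trans (Nat.mul_le_mul_left _ (Finset.card_le_card ?_))
        ((b v).card_range_mul_card_fiber_le (-a v))
      intro z hz
      exact Finset.mem_filter.2 ⟨Finset.mem_univ _,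
        eq_neg_of_add_eq_zero_right (Finset.mem_filter.1 hz).2⟩
  have hdouble := Finset.sum_card_bipartiteAbove_eq_sum_card_bipartiteBelow
    (s := bad) (t := U.erase 0) (fun z v => a v + b v z = 0)
  simp only [Finset.bipartiteAbove, Finset.bipartiteBelow] at hdouble
  have h1 : (Fintype.card F - 1) * bad.card ≤
      ∑ v ∈ U.erase 0, (bad.filter fun z => a v + b v z = 0).card := by
    rw [← hdouble, mul_comm]
    exact Finset.card_nsmul_le_sum _ _ _ hlow
  have hpos : 0 < Nat.card R := Nat.card_pos
  refine Nat.le_of_mul_le_mul_left ?_ hpos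
  calc Nat.card R * ((Fintype.card F - 1) * bad.card)
      ≤ Nat.card R * ∑ v ∈ U.erase 0, (bad.filter fun z => a v + b v z = 0).card :=
        Nat.mul_le_mul_left _ h1
    _ = ∑ v ∈ U.erase 0, Nat.card R * (bad.filter fun z => a v + b v z = 0).card :=
        Finset.mul_sum _ _ _
    _ ≤ ∑ _v ∈ U.erase 0, Fintype.card Ω := Finset.sum_le_sum hup
    _ = (U.erase 0).card * Fintype.card Ω := by rw [Finset.sum_const, smul_eq_mul]
    _ ≤ Nat.card R * Fintype.card Ω :=
        Nat.mul_le_mul_right _ ((Finset.card_le_card (Finset.erase_subset _ _)).trans hU)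

variable {I A ι κ : Type*}

open Classical in
/-- Coordinates are revealed block by block. If every property `P a` can be satisfied, and
rerandomizing one block destroys it with probability at most `β`, then all `#T` properties hold
with probability at least `(1 - #T β) ^ #s`, where `s` is the set of blocks. -/
theorem card_forall_ge_of_blocks [Fintype I] [DecidableEq I] [DecidableEq ι] [Fintype A] (ν : I → ι)
    (T : Finset κ) (P : κ → (I → A) → Prop) (β : ℝ) (hβ : T.card * β ≤ 1)
    (hex : ∀ a ∈ T, ∃ x, P a x)
    (hstep : ∀ a ∈ T, ∀ i x, P a x →
      ((Finset.univ.filter fun z : I → A => ¬ P a fun p => if ν p = i then z p else x p).card : ℝ) ≤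
        β * Fintype.card (I → A))
    (s : Finset ι) (hs : ∀ p, ν p ∈ s) :
    (1 - T.card * β) ^ s.card * Fintype.card (I → A) ≤
      ((Finset.univ.filter fun x : I → A => ∀ a ∈ T, P a x).card : ℝ) := by
  -- The completion `y` may depend on `a`: no joint completion is demanded until all blocks are
  -- exposed.
  let good : Finset ι → Finset (I → A) := fun s =>
    Finset.univ.filter fun x => ∀ a ∈ T, ∃ y, P a y ∧ ∀ p, ν p ∈ s → x p = y p
  have hgood : ∀ s x, x ∈ good s ↔ ∀ a ∈ T, ∃ y, P a y ∧ ∀ p, ν p ∈ s → x p = y p :=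
    fun s x => by simp [good]
  suffices h : ∀ s, (1 - T.card * β) ^ s.card * Fintype.card (I → A) ≤ ((good s).card : ℝ) by
    convert h s using 4 with x
    refine forall₂_congr fun a _ => ⟨fun hx => ⟨x, hx, fun _ _ => rfl⟩, ?_⟩
    rintro ⟨y, hy, hxy⟩
    rwa [show x = y from funext fun p => hxy p (hs p)]
  intro s
  induction s using Finset.induction_on with
  | empty =>
    rw [Finset.card_empty, pow_zero, one_mul]
    have : good ∅ = Finset.univ := Finset.eq_univ_of_forall fun x => (hgood _ _).2 fun a ha => by
      obtain ⟨y, hy⟩ := hex a ha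
      exact ⟨y, hy, by simp⟩
    rw [this, Finset.card_univ]
  | insert i s his ih =>
    let sp : (I → A) → (I → A) → I → A := fun x z p => if ν p = i then z p else x p
    have hsp : ∀ x z, sp (sp x z) (sp z x) = x := by
      intro x z
      ext p
      by_cases h : ν p = i <;> simp [sp, h]
    have hsub : good (insert i s) ⊆ good s := fun x hx => (hgood _ _).2 fun a ha => by
      obtain ⟨y, hy, hxy⟩ := (hgood _ _).1 hx a ha
      exact ⟨y, hy, fun p hp => hxy p (Finset.mem_insert_of_mem hp)⟩
    -- Exchanging block `i` between `x` and an independent `z` is an involution on pairs, so a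
    -- random `x` may be generated by resampling its block `i`.
    have h1 : ((good s \ good (insert i s)) ×ˢ (Finset.univ : Finset (I → A))).card ≤
        ∑ x ∈ good s, (Finset.univ.filter fun z => sp x z ∉ good (insert i s)).card := by
      rw [← Finset.card_sigma]
      refine Finset.card_le_card_of_injOn (fun q => ⟨sp q.1 q.2, sp q.2 q.1⟩) ?_ ?_
      · intro q hq
        obtain ⟨hq1, hq2⟩ := Finset.mem_sdiff.1 (Finset.mem_product.1 (Finset.mem_coe.1 hq)).1
        refine Finset.mem_coe.2 (Finset.mem_sigma.2 ⟨(hgood _ _).2 fun a ha => ?_, ?_⟩)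
        · obtain ⟨y, hy, hxy⟩ := (hgood _ _).1 hq1 a ha
          refine ⟨y, hy, fun p hp => ?_⟩
          have : ν p ≠ i := fun h => his (h ▸ hp)
          simp only [sp, this, if_false]
          exact hxy p hp
        · refine Finset.mem_filter.2 ⟨Finset.mem_univ _, ?_⟩
          simp only [hsp]
          exact hq2
      · intro q₁ _ q₂ _ h
        simp only [Sigma.mk.injEq, heq_eq_eq] at h
        refine Prod.ext ?_ ?_
        · rw [← hsp q₁.1 q₁.2, h.1, h.2, hsp]
        · rw [← hsp q₁.2 q₁.1, h.1, h.2, hsp]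
    have h2 : ∀ x ∈ good s,
        ((Finset.univ.filter fun z => sp x z ∉ good (insert i s)).card : ℝ) ≤
          T.card * β * Fintype.card (I → A) := by
      intro x hx
      have : Nonempty (I → A) := ⟨x⟩
      -- The spliced completion of `x` is a completion of the spliced `x` on the enlarged set of
      -- blocks, so failure for `a` means that resampling destroyed `P a` at `y a`.
      choose! y hy hxy using (hgood _ _).1 hx
      have hle : (Finset.univ.filter fun z => sp x z ∉ good (insert i s)).card ≤
          ∑ a ∈ T, (Finset.univ.filter fun z => ¬ P a (sp (y a) z)).card := by
        refine le_trans (Finset.card_le_card ?_) Finset.card_biUnion_le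
        intro z hz
        by_contra hcon
        refine (Finset.mem_filter.1 hz).2 ((hgood _ _).2 fun a ha => ⟨sp (y a) z, ?_, ?_⟩)
        · by_contra hP
          exact hcon (Finset.mem_biUnion.2 ⟨a, ha, Finset.mem_filter.2 ⟨Finset.mem_univ _, hP⟩⟩)
        · intro p hp
          by_cases h : ν p = i
          · simp [sp, h]
          · simp only [sp, h, if_false]
            exact hxy a ha p ((Finset.mem_insert.1 hp).resolve_left h)
      calc ((Finset.univ.filter fun z => sp x z ∉ good (insert i s)).card : ℝ)
          ≤ ∑ a ∈ T, ((Finset.univ.filter fun z => ¬ P a (sp (y a) z)).card : ℝ) := by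
            exact_mod_cast hle
        _ ≤ ∑ _a ∈ T, β * Fintype.card (I → A) :=
            Finset.sum_le_sum fun a ha => hstep a ha i (y a) (hy a ha)
        _ = T.card * β * Fintype.card (I → A) := by
            rw [Finset.sum_const, nsmul_eq_mul, mul_assoc]
    have h3 : ((good s \ good (insert i s)).card : ℝ) * Fintype.card (I → A) ≤
        (good s).card * (T.card * β) * Fintype.card (I → A) := by
      rw [Finset.card_product, Finset.card_univ] at h1
      calc ((good s \ good (insert i s)).card : ℝ) * Fintype.card (I → A)
          ≤ ∑ x ∈ good s,
              ((Finset.univ.filter fun z => sp x z ∉ good (insert i s)).card : ℝ) := by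
            exact_mod_cast h1
        _ ≤ ∑ _x ∈ good s, T.card * β * Fintype.card (I → A) := Finset.sum_le_sum h2
        _ = _ := by rw [Finset.sum_const, nsmul_eq_mul]; ring
    rw [Finset.card_insert_of_notMem his, pow_succ]
    rcases Nat.eq_zero_or_pos (Fintype.card (I → A)) with h0 | hpos
    · rw [h0, Nat.cast_zero, mul_zero]
      exact Nat.cast_nonneg _
    · have h4 := le_of_mul_le_mul_right h3 (Nat.cast_pos.2 hpos)
      have h5 : ((good s \ good (insert i s)).card : ℝ) = (good s).card - (good (insert i s)).card :=
        by rw [Finset.cast_card_sdiff hsub]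
      have h6 := mul_le_mul_of_nonneg_right ih (sub_nonneg.2 hβ)
      calc (1 - T.card * β) ^ s.card * (1 - T.card * β) * (Fintype.card (I → A) : ℝ)
          = (1 - T.card * β) ^ s.card * Fintype.card (I → A) * (1 - T.card * β) := by ring
        _ ≤ (good s).card * (1 - T.card * β) := h6
        _ ≤ (good (insert i s)).card := by
            rw [h5] at h4
            linarith

end Counting

/-! ### Rerandomizing the coefficients at one node -/

namespace Network

open Matrix

variable {V : Type u} {E : Type v}

namespace Code

variable [Fintype E] [DecidableEq E] [DecidableEq V] {N : Network V E}
variable {F : Type w} [Field F] {ω : ℕ}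

/-- The code `c` with its local coefficients at the node `i` replaced by those of `z`. -/
def splice (i : V) (c z : N.Code F ω) : N.Code F ω :=
  (fun p => if N.tail p.1.2 = i then z.1 p else c.1 p,
    fun p => if N.tail p.1.2 = i then z.2 p else c.2 p)

theorem relay_splice (i : V) (c z : N.Code F ω) (d e : E) :
    (splice i c z).relay d e = if N.tail e = i then z.relay d e else c.relay d e := by
  simp only [relay, splice, Matrix.of_apply]
  split_ifs <;> rfl

theorem inject_splice (i : V) (c z : N.Code F ω) (j : Fin ω) (e : E) :
    (splice i c z).inject j e = if N.tail e = i then z.inject j e else c.inject j e := by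
  simp only [inject, splice, Matrix.of_apply]
  split_ifs <;> rfl

theorem relay_zero : (0 : N.Code F ω).relay = 0 := by
  ext d e; simp [relay]

theorem inject_zero : (0 : N.Code F ω).inject = 0 := by
  ext d e; simp [inject]

theorem relay_add (z z' : N.Code F ω) : (z + z').relay = z.relay + z'.relay := by
  ext d e
  simp only [relay, Matrix.add_apply, Matrix.of_apply]
  split_ifs <;> simp

theorem inject_add (z z' : N.Code F ω) : (z + z').inject = z.inject + z'.inject := by
  ext d e
  simp only [inject, Matrix.add_apply, Matrix.of_apply]
  split_ifs <;> simp

theorem relay_smul (r : F) (z : N.Code F ω) : (r • z).relay = r • z.relay := by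
  ext d e
  simp only [relay, Matrix.smul_apply, Matrix.of_apply]
  split_ifs <;> simp

theorem inject_smul (r : F) (z : N.Code F ω) : (r • z).inject = r • z.inject := by
  ext d e
  simp only [inject, Matrix.smul_apply, Matrix.of_apply]
  split_ifs <;> simp

theorem exists_reflTransGen_of_signal_ne_zero (c : N.Code F ω) (Z : E → F) (d : E)
    (hd : c.signal (0, Z) d ≠ 0) : ∃ e, Z e ≠ 0 ∧ Relation.ReflTransGen N.Adj e d := by
  induction d using N.adj_wellFounded.induction with
  | _ d ih =>
    by_cases hZ : Z d = 0
    · have hs := c.signal_eq_apply (0, Z) d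
      simp only [Pi.zero_apply, zero_mul, Finset.sum_const_zero, hZ, zero_add] at hs
      rw [hs] at hd
      obtain ⟨d', -, hd'⟩ := Finset.exists_ne_zero_of_sum_ne_zero hd
      have hadj : N.Adj d' d := by
        by_contra h
        exact hd' (by rw [c.relay_eq_zero h, mul_zero])
      obtain ⟨e, he, hed⟩ := ih d' hadj (left_ne_zero_of_mul hd')
      exact ⟨e, he, hed.tail hadj⟩
    · exact ⟨d, hZ, .refl⟩

/-- The channels that leave the node `i`. -/
def outChannels (N : Network V E) (i : V) : Finset E :=
  Finset.univ.filter fun e => N.tail e = i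

/-- By acyclicity, what leaves a node never comes back to it. This is what makes the signal affine
in the coefficients of one node. -/
theorem signal_eq_zero_of_head_eq (c : N.Code F ω) {i : V} {Z : E → F}
    (hZ : Z ∈ matching F (outChannels N i)) {d : E} (hd : N.head d = i) :
    c.signal (0, Z) d = 0 := by
  by_contra h
  obtain ⟨e, he, hed⟩ := c.exists_reflTransGen_of_signal_ne_zero Z d h
  have : N.tail e = i := by
    by_contra hne
    exact he (hZ e fun h => hne (Finset.mem_filter.1 h).2)
  exact N.head_ne_tail_of_reflTransGen hed (hd.trans this.symm)

/-- The symbols that the node `i` sends when its local coefficients are those of `z`, and those of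
the other nodes are those of `c`. -/
noncomputable def sent (c : N.Code F ω) (i : V) :
    ((Fin ω → F) × (E → F)) →ₗ[F] N.Code F ω →ₗ[F] (E → F) :=
  LinearMap.mk₂ F
    (fun v z e => if N.tail e = i then
      ∑ j, v.1 j * z.inject j e + ∑ d, (splice i c 0).signal v d * z.relay d e else 0)
    (fun v v' z => by
      ext e
      simp only [Pi.add_apply, map_add, Prod.fst_add, add_mul, Finset.sum_add_distrib]
      split_ifs
      · ring
      · simp)
    (fun r v z => by
      ext e
      simp only [Pi.smul_apply, map_smul, Prod.smul_fst, smul_eq_mul, mul_assoc, ← Finset.mul_sum]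
      split_ifs
      · ring
      · simp)
    (fun v z z' => by
      ext e
      simp only [Pi.add_apply, relay_add, inject_add, Matrix.add_apply, mul_add,
        Finset.sum_add_distrib]
      split_ifs
      · ring
      · simp)
    (fun r v z => by
      ext e
      simp only [Pi.smul_apply, relay_smul, inject_smul, Matrix.smul_apply, smul_eq_mul,
        mul_left_comm _ r, ← Finset.mul_sum]
      split_ifs
      · ring
      · simp)

theorem sent_apply (c : N.Code F ω) (i : V) (v : (Fin ω → F) × (E → F)) (z : N.Code F ω) (e : E) :
    c.sent i v z e = if N.tail e = i then
      ∑ j, v.1 j * z.inject j e + ∑ d, (splice i c 0).signal v d * z.relay d e else 0 := rfl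

theorem sent_mem_matching (c : N.Code F ω) (i : V) (v : (Fin ω → F) × (E → F)) (z : N.Code F ω) :
    c.sent i v z ∈ matching F (outChannels N i) := by
  intro e he
  rw [sent_apply, if_neg fun h => he (Finset.mem_filter.2 ⟨Finset.mem_univ _, h⟩)]

/-- Switch node `i` off and inject what it would send as an error on its outgoing channels. Its
inputs are unaffected by this injection, so the sum satisfies the balance equations of the spliced
code. -/
theorem signal_splice (c z : N.Code F ω) (i : V) (v : (Fin ω → F) × (E → F)) :
    (splice i c z).signal v =
      (splice i c 0).signal v + (splice i c 0).signal (0, c.sent i v z) := by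
  symm
  rw [eq_signal_iff]
  ext e
  have h0 := (splice i c 0).signal_eq_apply v e
  have h1 := (splice i c 0).signal_eq_apply (0, c.sent i v z) e
  change _ = ∑ j, v.1 j * (splice i c z).inject j e + v.2 e +
    ∑ d, ((splice i c 0).signal v + (splice i c 0).signal (0, c.sent i v z)) d *
      (splice i c z).relay d e
  simp only [Pi.add_apply, Pi.zero_apply, zero_mul, Finset.sum_const_zero, zero_add, relay_splice,
    inject_splice] at h0 h1 ⊢
  by_cases h : N.tail e = i
  · have hsum : ∑ d, ((splice i c 0).signal v d +
        (splice i c 0).signal (0, c.sent i v z) d) * z.relay d e =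
        ∑ d, (splice i c 0).signal v d * z.relay d e := by
      refine Finset.sum_congr rfl fun d _ => ?_
      by_cases hde : N.Adj d e
      · rw [signal_eq_zero_of_head_eq _ (c.sent_mem_matching i v z) (hde.trans h), add_zero]
      · rw [z.relay_eq_zero hde, mul_zero, mul_zero]
    simp only [h, if_true, relay_zero, inject_zero, Matrix.zero_apply, mul_zero,
      Finset.sum_const_zero, zero_add, add_zero] at h0 h1 ⊢
    rw [hsum, h0, h1, sent_apply, if_pos h]
    ring
  · simp only [h, if_false, add_mul, Finset.sum_add_distrib] at h0 h1 ⊢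
    rw [h0, h1, sent_apply, if_neg h]
    ring

/-- One nonzero symbol available at `i` suffices: scaling it separately for each outgoing channel
produces any prescribed output. -/
theorem exists_sent_eq (c : N.Code F ω) {i : V} {v : (Fin ω → F) × (E → F)}
    (hv : ∃ z, c.sent i v z ≠ 0) {Z : E → F} (hZ : Z ∈ matching F (outChannels N i)) :
    ∃ z, c.sent i v z = Z := by
  have hZ' : ∀ e, N.tail e ≠ i → Z e = 0 := fun e he => hZ e fun h => he (Finset.mem_filter.1 h).2
  obtain ⟨z, hz⟩ := hv
  obtain ⟨e, he⟩ := Function.ne_iff.1 hz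
  rw [sent_apply, Pi.zero_apply] at he
  have hei : N.tail e = i := by
    by_contra h
    exact he (if_neg h)
  rw [if_pos hei] at he
  by_cases h1 : ∑ j, v.1 j * z.inject j e = 0
  · rw [h1, zero_add] at he
    obtain ⟨d, -, hd⟩ := Finset.exists_ne_zero_of_sum_ne_zero he
    have hd0 := left_ne_zero_of_mul hd
    have hdi : N.head d = i := by
      by_contra h
      exact hd (by rw [z.relay_eq_zero fun h' => h (h'.trans hei), mul_zero])
    refine ⟨(0, fun p => if p.1.1 = d then ((splice i c 0).signal v d)⁻¹ * Z p.1.2 else 0), ?_⟩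
    ext e'
    rw [sent_apply]
    split_ifs with h
    · rw [Finset.sum_eq_zero fun j _ => by simp [inject], zero_add, Finset.sum_eq_single d]
      · simp only [relay, Matrix.of_apply, dif_pos (hdi.trans h.symm), if_true]
        rw [mul_inv_cancel_left₀ hd0]
      · intro d' _ hd'
        simp [relay, hd']
      · simp
    · exact (hZ' e' h).symm
  · obtain ⟨j, -, hj⟩ := Finset.exists_ne_zero_of_sum_ne_zero h1
    have hj0 := left_ne_zero_of_mul hj
    have his : i = N.source := by
      by_contra h
      refine hj ?_
      have : N.tail e ≠ N.source := hei.symm ▸ h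
      simp [inject, this]
    refine ⟨(fun p => if p.1.1 = j then (v.1 j)⁻¹ * Z p.1.2 else 0, 0), ?_⟩
    ext e'
    rw [sent_apply]
    split_ifs with h
    · have hs : N.tail e' = N.source := h.trans his
      rw [Finset.sum_eq_zero (s := (Finset.univ : Finset E)) fun d _ => by simp [relay], add_zero,
        Finset.sum_eq_single j]
      · simp only [inject, Matrix.of_apply, dif_pos hs, if_true]
        rw [mul_inv_cancel_left₀ hj0]
      · intro j' _ hj'
        simp [inject, hj']
      · simp
    · exact (hZ' e' h).symm

theorem splice_self (i : V) (c : N.Code F ω) : splice i c c = c := by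
  simp [splice]

open Classical in
/-- Rerandomizing the local coefficients at one node destroys decodability with probability at most
`1 / (|F| - 1)`. -/
theorem Decodable.card_not_splice_le [Fintype F] {c : N.Code F ω} {t : V} {ρ : Finset E}
    (h : c.Decodable t ρ) (i : V) :
    (Fintype.card F - 1) *
      (Finset.univ.filter fun z : N.Code F ω => ¬ (splice i c z).Decodable t ρ).card ≤
        Fintype.card (N.Code F ω) := by
  have := Fintype.ofFinite (matching F ρ)
  let emb : ((Fin ω → F) × matching F ρ) →ₗ[F] ((Fin ω → F) × (E → F)) :=
    LinearMap.prodMap LinearMap.id (matching F ρ).subtype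
  let err : (E → F) →ₗ[F] ({e : E // N.head e = t} → F) :=
    (splice i c 0).received t ∘ₗ LinearMap.inr F (Fin ω → F) (E → F)
  let a := (splice i c 0).received t ∘ₗ emb
  let b : ((Fin ω → F) × matching F ρ) →ₗ[F] N.Code F ω →ₗ[F] ({e : E // N.head e = t} → F) :=
    (c.sent i ∘ₗ emb).compr₂ err
  have hb : ∀ v z, b v z = (splice i c 0).received t (0, c.sent i (emb v) z) := fun _ _ => rfl
  have hab : ∀ v z, a v + b v z = (splice i c z).received t (emb v) := by
    intro v z
    ext e
    exact (congrFun (c.signal_splice z i (emb v)) e.1).symm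
  have hdec : ∀ z, (splice i c z).Decodable t ρ ↔ ∀ v, a v + b v z = 0 → v = 0 := by
    intro z
    simp only [hab]
    constructor
    · intro hz v hv
      obtain ⟨h1, h2⟩ := hz v.1 v.2.1 v.2.2 hv
      exact Prod.ext h1 (Subtype.ext h2)
    · intro hz X Z hZ hr
      have := hz (X, ⟨Z, hZ⟩) hr
      exact ⟨congrArg Prod.fst this, congrArg (fun v => v.2.1) this⟩
  have hrange : ∀ v, b v = 0 ∨
      LinearMap.range (b v) = (splice i c 0).errorSpace t (outChannels N i) := by
    intro v
    by_cases hv : ∃ z, c.sent i (emb v) z ≠ 0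
    · right
      ext y
      rw [mem_errorSpace, LinearMap.mem_range]
      constructor
      · rintro ⟨z, hz⟩
        exact ⟨c.sent i (emb v) z, c.sent_mem_matching i (emb v) z, (hb v z).symm.trans hz⟩
      · rintro ⟨Z, hZ, hy⟩
        obtain ⟨z, hz⟩ := c.exists_sent_eq hv hZ
        exact ⟨z, by rw [hb, hz, hy]⟩
    · left
      push Not at hv
      refine LinearMap.ext fun z => ?_
      rw [hb, hv z]
      exact map_zero _
  -- The code `c` serves as the good point `z₀`, since splicing it into itself changes nothing.
  have key := LinearMap.card_not_injective_le a b _ hrange c ((hdec c).1 (by rwa [splice_self]))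
  rw [← Nat.card_eq_fintype_card (α := N.Code F ω)] at key ⊢
  convert key using 4 with z
  exact not_congr (hdec z)

end Code

end Network

/-! ### Reducing the dimension by one -/

namespace Network

open Matrix

variable {V : Type u} {E : Type v}

namespace Code

variable [Fintype E] [DecidableEq E] [DecidableEq V] {N : Network V E}
variable {F : Type w} [Field F] {n : ℕ}

/-- The local description of the code with the global description `reduce k (c.extKernel e)`. -/
def reduceCode (c : N.Code F (n + 1)) (k : Fin n → F) : N.Code F n :=
  (fun p => c.1 ⟨(p.1.1.castSucc, p.1.2), p.2⟩ + k p.1.1 * c.1 ⟨(Fin.last n, p.1.2), p.2⟩, c.2)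

theorem relay_reduceCode (c : N.Code F (n + 1)) (k : Fin n → F) :
    (c.reduceCode k).relay = c.relay := rfl

theorem inject_reduceCode (c : N.Code F (n + 1)) (k : Fin n → F) (i : Fin n) (e : E) :
    (c.reduceCode k).inject i e = c.inject i.castSucc e + k i * c.inject (Fin.last n) e := by
  by_cases h : N.tail e = N.source <;> simp [inject, reduceCode, h]

theorem transfer_reduceCode (c : N.Code F (n + 1)) (k : Fin n → F) :
    (c.reduceCode k).transfer = c.transfer := by
  have h := (c.reduceCode k).transfer_mul
  rw [relay_reduceCode] at h
  rw [← Matrix.mul_one (c.reduceCode k).transfer, ← c.mul_transfer, ← Matrix.mul_assoc, h,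
    Matrix.one_mul]

theorem extKernel_reduceCode (c : N.Code F (n + 1)) (k : Fin n → F) (e : E) :
    (c.reduceCode k).extKernel e = reduce k (c.extKernel e) := by
  ext (i | d)
  · change _ = c.extKernel e (Sum.inl i.castSucc) + k i * c.extKernel e (Sum.inl (Fin.last n))
    simp only [extKernel_inl, transfer_reduceCode, Matrix.mul_apply, inject_reduceCode, add_mul,
      Finset.sum_add_distrib, Finset.mul_sum, mul_assoc]
  · exact congrFun (congrFun (c.transfer_reduceCode k) d) e

/-- The message of length `n + 1` that `c` transmits when `c.reduceCode k` transmits `X`. -/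
def liftMessage (k : Fin n → F) (X : Fin n → F) : Fin (n + 1) → F :=
  Fin.snoc (α := fun _ => F) X (∑ i, X i * k i)

theorem received_reduceCode (c : N.Code F (n + 1)) (k : Fin n → F) (t : V) (X : Fin n → F)
    (Z : E → F) :
    (c.reduceCode k).received t (X, Z) = c.received t (liftMessage k X, Z) := by
  have h : X ᵥ* (c.reduceCode k).inject = liftMessage k X ᵥ* c.inject := by
    ext e
    simp only [Matrix.vecMul, dotProduct, inject_reduceCode, Fin.sum_univ_castSucc, liftMessage,
      Fin.snoc_castSucc, Fin.snoc_last, mul_add, Finset.sum_add_distrib, Finset.sum_mul, mul_assoc]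
  ext a
  simp only [received_apply, signal_apply, transfer_reduceCode, h]

theorem eq_zero_of_liftMessage_eq_zero {k X : Fin n → F} (h : liftMessage k X = 0) : X = 0 := by
  ext i
  have := congrFun h i.castSucc
  rwa [liftMessage, Fin.snoc_castSucc] at this

theorem liftMessage_zero (k : Fin n → F) : liftMessage k 0 = 0 := by
  ext i
  induction i using Fin.lastCases <;> simp [liftMessage]

theorem errorSpace_reduceCode (c : N.Code F (n + 1)) (k : Fin n → F) (t : V) (ρ : Finset E) :
    (c.reduceCode k).errorSpace t ρ = c.errorSpace t ρ := by
  ext y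
  simp only [mem_errorSpace, received_reduceCode, liftMessage_zero]

theorem messageSpace_reduceCode_le (c : N.Code F (n + 1)) (k : Fin n → F) (t : V) :
    (c.reduceCode k).messageSpace t ≤ c.messageSpace t := by
  intro y hy
  obtain ⟨X, rfl⟩ := (mem_messageSpace _ t y).1 hy
  exact (mem_messageSpace _ t _).2 ⟨_, (c.received_reduceCode k t X 0).symm⟩

theorem mem_Q (c : N.Code F (n + 1)) (t : V) (ρ : Finset E) :
    ρ ∈ c.Q t ↔ c.errorSpace t ρ ⊓ c.messageSpace t ≠ ⊥ ∧ ρ.card = c.minDist t := by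
  simp [Q]

/-- The redundancy grows by one and so equals the old minimum distance. Only patterns of exactly
this rank are new, and a smallest pattern dominating such a one belongs to `Q`. -/
theorem isMDS_reduceCode {c : N.Code F (n + 1)} (hc : c.IsMDS) (hn : 1 ≤ n)
    (hcut : ∀ t ∈ N.sinks, n + 1 ≤ N.minCut t) {k : Fin n → F}
    (h : ∀ t ∈ N.sinks, ∀ ρ ∈ c.Q t,
      c.errorSpace t ρ ⊓ (c.reduceCode k).messageSpace t = ⊥) : (c.reduceCode k).IsMDS := by
  have hreg : (c.reduceCode k).IsRegular := by
    intro t ht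
    refine finrank_messageSpace _ t fun X hX => ?_
    rw [received_reduceCode, c.received_eq_zero_iff t (hc.1 t ht)] at hX
    exact eq_zero_of_liftMessage_eq_zero hX
  refine ⟨hreg, fun t ht => ?_⟩
  have hcut' := hcut t ht
  refine minDist_add_eq _ (N.ne_source_of_mem_sinks ht) hn (by omega) (hreg t ht) fun ρ hρ => ?_
  rw [errorSpace_reduceCode]
  by_contra hne
  have hle := inf_le_inf_left (c.errorSpace t ρ) (c.messageSpace_reduceCode_le k t)
  have hne' : c.errorSpace t ρ ⊓ c.messageSpace t ≠ ⊥ := fun h' => hne (le_bot_iff.1 (h' ▸ hle))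
  have h1 := c.minDist_le hne'
  have h2 := hc.2 t ht
  rw [redundancy] at hρ
  obtain ⟨ρ', hdom, hcard⟩ := N.exists_dominated_card_eq_rank F t ρ
  have hρ' : ρ' ∈ c.Q t := (c.mem_Q t ρ').2
    ⟨fun h' => hne' (le_bot_iff.1 (h' ▸ inf_le_inf_right _ (hdom _ c))), by omega⟩
  exact hne (le_bot_iff.1 (h t ht ρ' hρ' ▸ inf_le_inf_right _ (hdom _ c)))

/-- For a pattern of minimal size the error space meets the message space in a line. -/
theorem exists_forall_eq_smul {c : N.Code F (n + 1)} {t : V}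
    (hreg : Module.finrank F (c.messageSpace t) = n + 1) {ρ : Finset E} (hρ : ρ ∈ c.Q t) :
    ∃ X₀ ≠ 0, ∀ X, c.received t (X, 0) ∈ c.errorSpace t ρ → ∃ r : F, X = r • X₀ := by
  obtain ⟨hne, hcard⟩ := (c.mem_Q t ρ).1 hρ
  obtain ⟨y, ⟨hy1, hy2⟩, hy0⟩ := Submodule.exists_mem_ne_zero_of_ne_bot hne
  obtain ⟨X₀, rfl⟩ := (c.mem_messageSpace t y).1 hy2
  obtain ⟨Z₀, hZ₀, hXZ₀⟩ := (c.mem_errorSpace t ρ _).1 hy1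
  have hZne : Z₀ ≠ 0 := by
    rintro rfl
    exact hy0 (hXZ₀.symm.trans (map_zero _))
  obtain ⟨e, he⟩ := Function.ne_iff.1 hZne
  rw [Pi.zero_apply] at he
  have heρ : e ∈ ρ := by
    by_contra h
    exact he (hZ₀ e h)
  -- Dropping a channel brings the rank below the minimum distance.
  have hbot : c.errorSpace t (ρ.erase e) ⊓ c.messageSpace t = ⊥ := by
    by_contra h
    have h1 := (c.minDist_le h).trans (rank_le_card t _)
    rw [Finset.card_erase_of_mem heρ] at h1
    have h2 : 0 < ρ.card := Finset.card_pos.2 ⟨e, heρ⟩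
    omega
  refine ⟨X₀, ?_, fun X hX => ?_⟩
  · rintro rfl
    exact hy0 (map_zero _)
  · obtain ⟨Z, hZ, hXZ⟩ := (c.mem_errorSpace t ρ _).1 hX
    -- This ratio cancels the error on `e`, leaving a vector in the trivial intersection for
    -- `ρ.erase e`.
    refine ⟨Z e / Z₀ e, sub_eq_zero.1 ((c.received_eq_zero_iff t hreg _).1 ?_)⟩
    set r := Z e / Z₀ e with hr
    have h1 : c.received t (X - r • X₀, 0) = c.received t (0, Z - r • Z₀) := by
      have e1 : (X - r • X₀, (0 : E → F)) = (X, 0) - r • (X₀, 0) := by simp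
      have e2 : ((0 : Fin (n + 1) → F), Z - r • Z₀) = (0, Z) - r • (0, Z₀) := by simp
      rw [e1, e2, map_sub, map_sub, map_smul, map_smul, hXZ₀, hXZ]
    have h2 : c.received t (X - r • X₀, 0) ∈
        c.errorSpace t (ρ.erase e) ⊓ c.messageSpace t := by
      refine ⟨(c.mem_errorSpace t _ _).2 ⟨Z - r • Z₀, fun d hd => ?_, h1.symm⟩,
        (c.mem_messageSpace t _).2 ⟨_, rfl⟩⟩
      by_cases hde : d = e
      · rw [hde, Pi.sub_apply, Pi.smul_apply, smul_eq_mul, hr, div_mul_cancel₀ _ he, sub_self]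
      · have hd' : d ∉ ρ := fun h => hd (Finset.mem_erase.2 ⟨hde, h⟩)
        rw [Pi.sub_apply, Pi.smul_apply, hZ d hd', hZ₀ d hd', smul_zero, sub_zero]
    rw [hbot] at h2
    exact (Submodule.mem_bot F).1 h2

-- The bad `k` satisfy ∑ X₀_i k_i = X₀_last, with `X₀` spanning the line for `ρ`. If all
-- coefficients on the left vanish, then X₀ ≠ 0 makes the equation unsolvable; otherwise its
-- solutions form a fiber of a surjection onto F.
open Classical in
theorem card_mul_card_meets_le [Fintype F] {c : N.Code F (n + 1)} {t : V}
    (hreg : Module.finrank F (c.messageSpace t) = n + 1) {ρ : Finset E} (hρ : ρ ∈ c.Q t) :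
    Fintype.card F * (Finset.univ.filter fun k : Fin n → F =>
      c.errorSpace t ρ ⊓ (c.reduceCode k).messageSpace t ≠ ⊥).card ≤
        Fintype.card (Fin n → F) := by
  obtain ⟨X₀, hX₀, hline⟩ := exists_forall_eq_smul hreg hρ
  let f : (Fin n → F) →ₗ[F] F := ∑ i, X₀ i.castSucc • LinearMap.proj i
  have hf : ∀ k, f k = ∑ i, X₀ i.castSucc * k i := fun k => by simp [f, LinearMap.sum_apply]
  have hsub : (Finset.univ.filter fun k : Fin n → F =>
      c.errorSpace t ρ ⊓ (c.reduceCode k).messageSpace t ≠ ⊥) ⊆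
      Finset.univ.filter fun k => f k = X₀ (Fin.last n) := by
    intro k hk
    obtain ⟨y, ⟨hy1, hy2⟩, hy0⟩ :=
      Submodule.exists_mem_ne_zero_of_ne_bot (Finset.mem_filter.1 hk).2
    obtain ⟨X, rfl⟩ := (mem_messageSpace _ t y).1 hy2
    rw [received_reduceCode] at hy1 hy0
    obtain ⟨r, hr⟩ := hline _ hy1
    have hr0 : r ≠ 0 := by
      rintro rfl
      rw [hr, zero_smul] at hy0
      exact hy0 (map_zero _)
    have hX : ∀ i, X i = r * X₀ i.castSucc := fun i => by
      have := congrFun hr i.castSucc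
      rwa [liftMessage, Fin.snoc_castSucc] at this
    have hlast := congrFun hr (Fin.last n)
    rw [liftMessage, Fin.snoc_last, Pi.smul_apply, smul_eq_mul] at hlast
    simp only [hX, mul_assoc, ← Finset.mul_sum] at hlast
    refine Finset.mem_filter.2 ⟨Finset.mem_univ _, ?_⟩
    rw [hf]
    exact mul_left_cancel₀ hr0 hlast
  by_cases hf0 : f = 0
  · have hempty : (Finset.univ.filter fun k => f k = X₀ (Fin.last n)) = ∅ := by
      refine Finset.filter_false_of_mem fun k _ hk => hX₀ ?_
      ext i
      induction i using Fin.lastCases with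
      | last => rw [← hk, hf0]; rfl
      | cast i =>
        have h := hf (Pi.single i 1)
        rw [hf0] at h
        simpa [Pi.single_apply] using h.symm
    rw [hempty] at hsub
    rw [Finset.subset_empty.1 hsub, Finset.card_empty, mul_zero]
    exact Nat.zero_le _
  · have hrange : LinearMap.range f = ⊤ := LinearMap.range_eq_top.2 (LinearMap.surjective hf0)
    have key := f.card_range_mul_card_fiber_le (X₀ (Fin.last n))
    rw [hrange, Nat.card_congr Submodule.topEquiv.toEquiv, Nat.card_eq_fintype_card] at key
    exact le_trans (Nat.mul_le_mul_left _ (Finset.card_le_card hsub)) key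

open Classical in
theorem card_mul_card_not_reducesToMDS_le [Fintype F] {c : N.Code F (n + 1)} (hc : c.IsMDS)
    (hn : 1 ≤ n) (hcut : ∀ t ∈ N.sinks, n + 1 ≤ N.minCut t) :
    Fintype.card F * (Finset.univ.filter fun k : Fin n → F => ¬ c.ReducesToMDS k).card ≤
      (∑ t ∈ N.sinks, (c.Q t).card) * Fintype.card (Fin n → F) := by
  have hsub : (Finset.univ.filter fun k : Fin n → F => ¬ c.ReducesToMDS k) ⊆
      (N.sinks.sigma fun t => c.Q t).biUnion fun a => Finset.univ.filter fun k : Fin n → F =>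
        c.errorSpace a.1 a.2 ⊓ (c.reduceCode k).messageSpace a.1 ≠ ⊥ := by
    intro k hk
    by_contra hcon
    refine (Finset.mem_filter.1 hk).2 ⟨c.reduceCode k, rfl, c.extKernel_reduceCode k,
      isMDS_reduceCode hc hn hcut fun t ht ρ hρ => ?_⟩
    by_contra hne
    exact hcon (Finset.mem_biUnion.2 ⟨⟨t, ρ⟩, Finset.mem_sigma.2 ⟨ht, hρ⟩,
      Finset.mem_filter.2 ⟨Finset.mem_univ _, hne⟩⟩)
  calc Fintype.card F * (Finset.univ.filter fun k : Fin n → F => ¬ c.ReducesToMDS k).card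
      ≤ Fintype.card F * ∑ a ∈ N.sinks.sigma fun t => c.Q t, (Finset.univ.filter
          fun k : Fin n → F =>
            c.errorSpace a.1 a.2 ⊓ (c.reduceCode k).messageSpace a.1 ≠ ⊥).card :=
        Nat.mul_le_mul_left _ ((Finset.card_le_card hsub).trans Finset.card_biUnion_le)
    _ ≤ ∑ _a ∈ N.sinks.sigma fun t => c.Q t, Fintype.card (Fin n → F) := by
        rw [Finset.mul_sum]
        refine Finset.sum_le_sum fun a ha => ?_
        obtain ⟨ht, hρ⟩ := Finset.mem_sigma.1 ha
        exact card_mul_card_meets_le (hc.1 a.1 ht) hρ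
    _ = _ := by rw [Finset.sum_const, Finset.card_sigma, smul_eq_mul]

end Code

end Network

/-! ### From counts to probabilities, and the limit -/

namespace Network

variable {V : Type u} {E : Type v}

section Probability

open Classical in
theorem unifProb_eq {α : Type*} [Fintype α] [Nonempty α] (A : Set α) :
    unifProb A = ((Finset.univ.filter fun x => x ∈ A).card : ℝ) / Fintype.card α := by
  rw [unifProb, PMF.toOuterMeasure_uniformOfFintype_apply, Fintype.card_subtype]
  simp

theorem unifProb_nonneg {α : Type*} [Fintype α] [Nonempty α] (A : Set α) : 0 ≤ unifProb A :=
  ENNReal.toReal_nonneg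

theorem unifProb_le_one {α : Type*} [Fintype α] [Nonempty α] (A : Set α) : unifProb A ≤ 1 := by
  classical
  rw [unifProb_eq]
  refine div_le_one_of_le₀ ?_ (Nat.cast_nonneg _)
  exact_mod_cast Finset.card_le_univ _

open Classical in
theorem one_sub_le_unifProb {α : Type*} [Fintype α] [Nonempty α] (A : Set α) {m q : ℕ}
    (hq : 0 < q)
    (h : q * (Finset.univ.filter fun x => x ∉ A).card ≤ m * Fintype.card α) :
    1 - (m : ℝ) / q ≤ unifProb A := by
  have hα : (0 : ℝ) < Fintype.card α := Nat.cast_pos.2 Fintype.card_pos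
  have hq' : (0 : ℝ) < q := Nat.cast_pos.2 hq
  have h1 : ((Finset.univ.filter fun x => x ∈ A).card : ℝ) +
      (Finset.univ.filter fun x => x ∉ A).card = Fintype.card α := by
    exact_mod_cast Finset.card_filter_add_card_filter_not (s := (Finset.univ : Finset α)) (· ∈ A)
  have h2 : (q : ℝ) * (Finset.univ.filter fun x => x ∉ A).card ≤ m * Fintype.card α := by
    exact_mod_cast h
  rw [unifProb_eq, le_div_iff₀ hα, sub_mul, one_mul, sub_le_comm, ← h1, add_sub_cancel_left, h1,
    div_mul_eq_mul_div, le_div_iff₀ hq', mul_comm]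
  exact h2

open Classical in
theorem unifProb_prod {α β : Type*} [Fintype α] [Nonempty α] [Fintype β] [Nonempty β]
    (P : α → Prop) (B : α → Set β) (A : Set (α × β)) (hA : ∀ x, x ∈ A ↔ P x.1 ∧ x.2 ∈ B x.1) :
    unifProb A = (∑ a with P a, unifProb (B a)) / Fintype.card α := by
  have h : (Finset.univ.filter fun x : α × β => x ∈ A).card =
      ∑ a with P a, (Finset.univ.filter fun b => b ∈ B a).card := by
    rw [← Finset.card_sigma]
    refine Finset.card_equiv (Equiv.sigmaEquivProd α β).symm fun x => ?_
    simp [hA]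
  rw [unifProb_eq, h, Fintype.card_prod, Nat.cast_mul, Nat.cast_sum, mul_comm, ← div_div,
    Finset.sum_div]
  simp only [unifProb_eq]

end Probability

section Bounds

variable [Fintype V] [Fintype E] [DecidableEq E] [DecidableEq V] {N : Network V E}
variable {F : Type w} [Field F] [Fintype F] {ω : ℕ}

theorem sumR_eq_card : N.sumR F ω =
    ((N.sinks.sigma fun t => N.R F t (N.redundancy ω t)).card : ℝ) := by
  rw [Finset.card_sigma, Nat.cast_sum, sumR]

open Classical in
/-- A random code is network MDS with probability at least
`(1 - ∑_t |R_t(δ_t)| / (|F| - 1)) ^ (|J| + 1)`. -/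
theorem card_isMDS_ge (hω : 1 ≤ ω) (hcut : ∀ t ∈ N.sinks, ω ≤ N.minCut t)
    (hR : N.sumR F ω ≤ (Fintype.card F : ℝ) - 1) :
    (1 - N.sumR F ω / ((Fintype.card F : ℝ) - 1)) ^ (N.internalNodes.card + 1) *
        Fintype.card (N.Code F ω) ≤
      ((Finset.univ.filter fun c : N.Code F ω => c.IsMDS).card : ℝ) := by
  have hq : (0 : ℝ) < (Fintype.card F : ℝ) - 1 := by
    have : (1 : ℝ) < Fintype.card F := by exact_mod_cast Fintype.one_lt_card (α := F)
    linarith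
  let T := N.sinks.sigma fun t => N.R F t (N.redundancy ω t)
  let e : ({p : Fin ω × E // N.tail p.2 = N.source} ⊕ {p : E × E // N.head p.1 = N.tail p.2} → F) ≃
      N.Code F ω := Equiv.sumArrowEquivProdArrow _ _ _
  let ν : {p : Fin ω × E // N.tail p.2 = N.source} ⊕ {p : E × E // N.head p.1 = N.tail p.2} → V :=
    Sum.elim (fun p => N.tail p.1.2) (fun p => N.tail p.1.2)
  let P : (_ : V) × Finset E →
      ({p : Fin ω × E // N.tail p.2 = N.source} ⊕ {p : E × E // N.head p.1 = N.tail p.2} → F) →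
      Prop := fun a x => (e x).Decodable a.1 a.2
  have hcard : Fintype.card (N.Code F ω) = Fintype.card
      ({p : Fin ω × E // N.tail p.2 = N.source} ⊕ {p : E × E // N.head p.1 = N.tail p.2} → F) :=
    (Fintype.card_congr e).symm
  have hsplice : ∀ i x z, e (fun p => if ν p = i then z p else x p) =
      Code.splice i (e x) (e z) := fun _ _ _ => rfl
  have hT : ∀ a ∈ T, a.1 ≠ N.source ∧ N.rank F a.1 a.2 = a.2.card ∧
      ω + a.2.card ≤ N.minCut a.1 := by
    intro a ha
    obtain ⟨ht, hρ⟩ := Finset.mem_sigma.1 ha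
    obtain ⟨h1, h2⟩ := (Finset.mem_filter.1 hρ).2
    refine ⟨N.ne_source_of_mem_sinks ht, h2.trans h1.symm, ?_⟩
    have := hcut a.1 ht
    rw [h1, redundancy]
    omega
  -- The blocks are the coefficients at the source and at the internal nodes; sinks have no outgoing
  -- channels.
  have hmain := card_forall_ge_of_blocks ν T P (1 / ((Fintype.card F : ℝ) - 1)) ?_ ?_ ?_
    (insert N.source N.internalNodes) ?_
  · have hsrc : N.source ∉ N.internalNodes := by simp [internalNodes]
    rw [Finset.card_insert_of_notMem hsrc, mul_one_div, ← sumR_eq_card, ← hcard] at hmain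
    refine hmain.trans ?_
    rw [Nat.cast_le]
    refine Finset.card_le_card_of_injOn e (fun x hx => ?_) e.injective.injOn
    have hx' : ∀ a ∈ T, P a x := by
      simpa only [Finset.coe_filter, Set.mem_ofPred_eq, Finset.mem_univ, true_and] using hx
    refine Finset.mem_coe.2 (Finset.mem_filter.2 ⟨Finset.mem_univ _,
      Code.isMDS_of_decodable hω hcut _ fun t ht ρ hρ => ?_⟩)
    exact hx' ⟨t, ρ⟩ (Finset.mem_sigma.2 ⟨ht, hρ⟩)
  · rw [mul_one_div, ← sumR_eq_card]
    exact div_le_one_of_le₀ hR hq.le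
  · intro a ha
    obtain ⟨h1, h2, h3⟩ := hT a ha
    obtain ⟨c, hc⟩ := Code.exists_decodable h1 h2 h3
    exact ⟨e.symm c, by simpa only [P, Equiv.apply_symm_apply] using hc⟩
  · intro a _ i x hx
    have h1 := Code.Decodable.card_not_splice_le (c := e x) hx i
    have h2 : (Finset.univ.filter fun z : {p : Fin ω × E // N.tail p.2 = N.source} ⊕
        {p : E × E // N.head p.1 = N.tail p.2} → F =>
          ¬ P a fun p => if ν p = i then z p else x p).card =
        (Finset.univ.filter fun z : N.Code F ω =>
          ¬ (Code.splice i (e x) z).Decodable a.1 a.2).card :=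
      Finset.card_equiv e fun z => by simp only [Finset.mem_filter_univ, P, hsplice]
    rw [← h2, hcard] at h1
    rw [one_div, inv_mul_eq_div, le_div_iff₀ hq, mul_comm]
    have h3 : ((Fintype.card F - 1 : ℕ) : ℝ) = (Fintype.card F : ℝ) - 1 := by
      rw [Nat.cast_sub Fintype.card_pos, Nat.cast_one]
    rw [← h3]
    exact_mod_cast h1
  · have key : ∀ d, N.tail d ∈ insert N.source N.internalNodes := by
      intro d
      by_cases h : N.tail d = N.source
      · exact Finset.mem_insert.2 (Or.inl h)
      · refine Finset.mem_insert_of_mem ?_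
        simp [internalNodes, h, N.tail_notMem_sinks d]
    rintro (p | p)
    · exact key p.1.2
    · exact key p.1.2

theorem one_sub_le_unifProb_reducesToMDS (hω : 2 ≤ ω) (hcut : ∀ t ∈ N.sinks, ω ≤ N.minCut t)
    {c : N.Code F ω} (hc : c.IsMDS) :
    1 - (∑ t ∈ N.sinks, ((c.Q t).card : ℝ)) / (Fintype.card F : ℝ) ≤
      unifProb {k : Fin (ω - 1) → F | c.ReducesToMDS k} := by
  classical
  obtain ⟨n, rfl⟩ : ∃ n, ω = n + 1 := ⟨ω - 1, by omega⟩
  rw [← Nat.cast_sum]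
  exact one_sub_le_unifProb _ Fintype.card_pos
    (Code.card_mul_card_not_reducesToMDS_le hc (by omega) hcut)

theorem successProb_nonneg : 0 ≤ N.successProb F ω := unifProb_nonneg _

theorem successProb_le_one : N.successProb F ω ≤ 1 := unifProb_le_one _

theorem lowerBound_le_successProb (hω : 2 ≤ ω) (hcut : ∀ t ∈ N.sinks, ω ≤ N.minCut t)
    (hR : N.sumR F ω ≤ (Fintype.card F : ℝ) - 1) :
    N.lowerBound F ω ≤ N.successProb F ω := by
  classical
  have hq : (0 : ℝ) < (Fintype.card F : ℝ) - 1 := by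
    have : (1 : ℝ) < Fintype.card F := by exact_mod_cast Fintype.one_lt_card (α := F)
    linarith
  have hcode : (0 : ℝ) < Fintype.card (N.Code F ω) := Nat.cast_pos.2 Fintype.card_pos
  have hpow : 0 ≤ (1 - N.sumR F ω / ((Fintype.card F : ℝ) - 1)) ^ (N.internalNodes.card + 1) :=
    pow_nonneg (sub_nonneg.2 (div_le_one_of_le₀ hR hq.le)) _
  -- The count of MDS codes may be multiplied by this factor only if the factor is nonnegative;
  -- otherwise the bound is trivial.
  rcases le_or_gt (1 - N.meanQ F ω / (Fintype.card F : ℝ)) 0 with hneg | hpos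
  · exact (mul_nonpos_of_nonpos_of_nonneg hneg hpow).trans successProb_nonneg
  have hM := card_isMDS_ge (by omega) hcut hR
  set M := Finset.univ.filter fun c : N.Code F ω => c.IsMDS with hMdef
  have hsum : (M.card : ℝ) * (1 - N.meanQ F ω / (Fintype.card F : ℝ)) ≤
      ∑ c ∈ M, unifProb {k : Fin (ω - 1) → F | c.ReducesToMDS k} := by
    have h1 : (M.card : ℝ) * (1 - N.meanQ F ω / (Fintype.card F : ℝ)) =
        ∑ c ∈ M, (1 - (∑ t ∈ N.sinks, ((c.Q t).card : ℝ)) / (Fintype.card F : ℝ)) := by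
      rw [Finset.sum_sub_distrib, ← Finset.sum_div, Finset.sum_const, nsmul_eq_mul, mul_one,
        mul_sub, mul_one, ← mul_div_assoc]
      congr 2
      -- With no MDS code the average is a division by zero, but it is multiplied by |M| = 0.
      rcases M.eq_empty_or_nonempty with h | h
      · rw [h, Finset.card_empty, Nat.cast_zero, zero_mul, Finset.sum_empty]
      · exact mul_div_cancel₀ _ (Nat.cast_ne_zero.2 (Finset.card_pos.2 h).ne')
    rw [h1]
    exact Finset.sum_le_sum fun c hc =>
      one_sub_le_unifProb_reducesToMDS hω hcut (Finset.mem_filter.1 hc).2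
  have hsucc : N.successProb F ω = (∑ c ∈ M, unifProb {k : Fin (ω - 1) → F | c.ReducesToMDS k}) /
      Fintype.card (N.Code F ω) :=
    unifProb_prod (fun c : N.Code F ω => c.IsMDS) (fun c => {k | c.ReducesToMDS k}) _
      fun _ => Iff.rfl
  rw [hsucc, le_div_iff₀ hcode, lowerBound, mul_assoc, mul_comm (1 - N.meanQ F ω / _)]
  exact (mul_le_mul_of_nonneg_right hM hpos.le).trans hsum

theorem sumR_nonneg : 0 ≤ N.sumR F ω := Finset.sum_nonneg fun _ _ => Nat.cast_nonneg _

theorem sumR_le : N.sumR F ω ≤ N.sinks.card * Fintype.card (Finset E) := by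
  rw [sumR, ← nsmul_eq_mul]
  exact Finset.sum_le_card_nsmul _ _ _ fun t _ => by exact_mod_cast Finset.card_le_univ _

theorem meanQ_nonneg : 0 ≤ N.meanQ F ω :=
  div_nonneg (Finset.sum_nonneg fun _ _ => Finset.sum_nonneg fun _ _ => Nat.cast_nonneg _)
    (Nat.cast_nonneg _)

theorem meanQ_le : N.meanQ F ω ≤ N.sinks.card * Fintype.card (Finset E) := by
  refine div_le_of_le_mul₀ (Nat.cast_nonneg _) (by positivity) ?_
  rw [mul_comm, ← nsmul_eq_mul]
  refine Finset.sum_le_card_nsmul _ _ _ fun c _ => ?_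
  rw [← nsmul_eq_mul]
  exact Finset.sum_le_card_nsmul _ _ _ fun t _ => by exact_mod_cast Finset.card_le_univ _

theorem lowerBound_le_one (hR : N.sumR F ω ≤ (Fintype.card F : ℝ) - 1) :
    N.lowerBound F ω ≤ 1 := by
  have hq : (0 : ℝ) < (Fintype.card F : ℝ) - 1 := by
    have : (1 : ℝ) < Fintype.card F := by exact_mod_cast Fintype.one_lt_card (α := F)
    linarith
  have h0 : 0 ≤ 1 - N.sumR F ω / ((Fintype.card F : ℝ) - 1) :=
    sub_nonneg.2 (div_le_one_of_le₀ hR hq.le)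
  refine mul_le_one₀ ?_ (pow_nonneg h0 _) (pow_le_one₀ h0 ?_)
  · exact sub_le_self _ (div_nonneg meanQ_nonneg (Nat.cast_nonneg _))
  · exact sub_le_self _ (div_nonneg sumR_nonneg hq.le)

/-- All |J| + 2 factors are at least 1 - B/(|F| - 1), and Bernoulli's inequality linearizes their
product. -/
theorem le_lowerBound {B : ℝ} (hB : N.sinks.card * Fintype.card (Finset E) ≤ B)
    (hBq : B ≤ (Fintype.card F : ℝ) - 1) :
    1 - (N.internalNodes.card + 2) * (B / ((Fintype.card F : ℝ) - 1)) ≤ N.lowerBound F ω := by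
  have hq : (0 : ℝ) < (Fintype.card F : ℝ) - 1 := by
    have : (1 : ℝ) < Fintype.card F := by exact_mod_cast Fintype.one_lt_card (α := F)
    linarith
  have hB0 : 0 ≤ B := le_trans (by positivity) hB
  have h0 : 0 ≤ 1 - B / ((Fintype.card F : ℝ) - 1) :=
    sub_nonneg.2 (div_le_one_of_le₀ hBq hq.le)
  have h1 : 1 - B / ((Fintype.card F : ℝ) - 1) ≤ 1 - N.meanQ F ω / (Fintype.card F : ℝ) :=
    sub_le_sub_left (div_le_div₀ hB0 (meanQ_le.trans hB) hq (by linarith)) 1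
  have h2 : 1 - B / ((Fintype.card F : ℝ) - 1) ≤
      1 - N.sumR F ω / ((Fintype.card F : ℝ) - 1) :=
    sub_le_sub_left (div_le_div_of_nonneg_right (sumR_le.trans hB) hq.le) 1
  have h3 := one_add_mul_le_pow (a := -(B / ((Fintype.card F : ℝ) - 1))) (by linarith)
    (N.internalNodes.card + 2)
  calc 1 - (N.internalNodes.card + 2) * (B / ((Fintype.card F : ℝ) - 1))
      = 1 + ((N.internalNodes.card + 2 : ℕ) : ℝ) * -(B / ((Fintype.card F : ℝ) - 1)) := by
        push_cast; ring
    _ ≤ (1 - B / ((Fintype.card F : ℝ) - 1)) ^ (N.internalNodes.card + 2) := by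
        rwa [← sub_eq_add_neg 1] at h3
    _ = (1 - B / ((Fintype.card F : ℝ) - 1)) *
          (1 - B / ((Fintype.card F : ℝ) - 1)) ^ (N.internalNodes.card + 1) := pow_succ' _ _
    _ ≤ N.lowerBound F ω :=
        mul_le_mul h1 (pow_le_pow_left₀ h0 h2 _) (pow_nonneg h0 _) (h0.trans h1)

end Bounds

end Network

theorem mainTheorem4 {V : Type u} {E : Type v} [Fintype V] [Fintype E] [DecidableEq V]
    [DecidableEq E] (N : Network V E) (ω : ℕ) (hω : 2 ≤ ω)
    (hcut : ∀ t ∈ N.sinks, ω ≤ N.minCut t) :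
    (∀ (F : Type w) [Field F] [Fintype F],
      (∀ c : N.Code F ω, c.IsMDS →
        1 - (∑ t ∈ N.sinks, ((c.Q t).card : ℝ)) / (Fintype.card F : ℝ) ≤
          Network.unifProb {k : Fin (ω - 1) → F | c.ReducesToMDS k}) ∧
      (N.sumR F ω ≤ (Fintype.card F : ℝ) - 1 →
        N.lowerBound F ω ≤ N.successProb F ω)) ∧
    (∀ ε : ℝ, 0 < ε → ∃ q₀ : ℕ, ∀ (F : Type w) [Field F] [Fintype F],
      q₀ ≤ Fintype.card F →
        |N.lowerBound F ω - 1| < ε ∧ |N.successProb F ω - 1| < ε) := by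
  refine ⟨fun F _ _ => ⟨fun c hc => Network.one_sub_le_unifProb_reducesToMDS hω hcut hc,
    Network.lowerBound_le_successProb hω hcut⟩, fun ε hε => ?_⟩
  set B : ℝ := N.sinks.card * Fintype.card (Finset E) with hB
  have hB0 : 0 ≤ B := by positivity
  -- The first term secures the hypothesis of the second claim, the second makes the Bernoulli error
  -- less than `ε`, and the 2 keeps the inequality strict after passing to |F| - 1.
  refine ⟨⌈B⌉₊ + ⌈(N.internalNodes.card + 2) * B / ε⌉₊ + 2, fun F _ _ hF => ?_⟩
  have hF' : (⌈B⌉₊ : ℝ) + ⌈(N.internalNodes.card + 2) * B / ε⌉₊ + 2 ≤ Fintype.card F := by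
    exact_mod_cast hF
  have h1 := Nat.le_ceil B
  have h2 := Nat.le_ceil ((N.internalNodes.card + 2) * B / ε)
  have h3 : 0 ≤ (N.internalNodes.card + 2) * B / ε := by positivity
  have hBq : B ≤ (Fintype.card F : ℝ) - 1 := by linarith
  have hq : (0 : ℝ) < (Fintype.card F : ℝ) - 1 := by linarith
  have hR : N.sumR F ω ≤ (Fintype.card F : ℝ) - 1 := Network.sumR_le.trans hBq
  have hlow : 1 - ε < N.lowerBound F ω := by
    refine lt_of_lt_of_le ?_ (Network.le_lowerBound hB.ge hBq)
    rw [← mul_div_assoc, sub_lt_sub_iff_left, div_lt_iff₀ hq, mul_comm ε, ← div_lt_iff₀ hε]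
    linarith
  have hle := Network.lowerBound_le_successProb hω hcut hR
  have hone := Network.lowerBound_le_one hR
  have hsucc := Network.successProb_le_one (N := N) (F := F) (ω := ω)
  constructor <;> rw [abs_sub_lt_iff] <;> constructor <;> linarith
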